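/- Let $W$ be the Weyl group of type $G_2$, acting on $\bar X=\{(a,b,c)\in\mathbb Z^3: a+b+c=0\}$ and generated by $s_1:(a,b,c)\mapsto(b,a,c)$ and $s_2:(a,b,c)\mapsto(-a,-c,-b)$; let $\ell$ be its length function and $y<w$ the Bruhat order; write $\mathbf i\cdot w=w^{-1}(\mathbf i)$. Let $\mathcal A=\mathbb Z[q,q^{-1}]$ and let $\mathcal H$ be the $\mathcal A$-algebra with generators $H_1,H_2$ and relations $(H_k-q^{-1})(H_k+q)=0$, $(H_1H_2)^3=(H_2H_1)^3$. Let $n\ge 0$ be an integer. Let $\Lambda_n$ be the set of formal sums $\varepsilon_a+\varepsilon_b$ with $0\le a\le b\le n$; for $\gamma=\varepsilon_a+\varepsilon_b\in\Lambda_n$ put $\mathbf i^-_\gamma=(a,b,-a-b)$, let $W_\gamma$ be the subgroup of $W$ generated by those $s_k$ which fix $\mathbf i^-_\gamma$, and let $w_\circ^\gamma$ be its longest element. Let $\bar X_n$ be the union of the $W$-orbits of the $\mathbf i^-_\gamma$, $\gamma\in\Lambda_n$. The free $\mathcal A$-module $\mathbb T_n$ with basis $\{v_{\mathbf i}\}_{\mathbf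 i\in\bar X_n}$ is a right $\mathcal H$-module via $$v_{\mathbf i}H_k=\begin{cases}q^{-1}v_{\mathbf i}&(m=0)\\ v_{\mathbf i\cdot s_k}&(m>0)\\ v_{\mathbf i\cdot s_k}+(q^{-1}-q)v_{\mathbf i}&(m<0)\end{cases}\qquad (\mathbf i=(a,b,c)),$$ where $m=b-a$ if $k=1$ and $m=a$ if $k=2$. Put $\mathcal S_q(n)=\mathrm{End}_{\mathcal H}(\mathbb T_n)$ and $\mathcal S_q(n)_{\mathbb Q}=\mathbb Q(q)\otimes_{\mathcal A}\mathcal S_q(n)$. For $\gamma,\nu\in\Lambda_n$ and $g$ a minimal length representative of a double coset in $W_\gamma\backslash W/W_\nu$, with $g^+$ the longest element of $W_\gamma gW_\nu$, the standard basis element $[\phi^g_{\gamma\nu}]\in\mathcal S_q(n)$ is the $\mathcal H$-linear map with $[\phi^g_{\gamma\nu}](v_{\mathbf i^-_{\nu'}})=0$ for $\nu'\ne\nu$ and $$[\phi^g_{\gamma\nu}](v_{\mathbf i^-_\nu})=\sum_w q^{\ell(g^+)-\ell(w_\circ^\gamma)-\ell(w)}\,v_{\mathbf i^-_\gamma\cdot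 w},$$ where $w$ runs over the minimal length representatives of the cosets $W_\gamma w\subseteq W_\gamma gW_\nu$. Let $\overline{\phantom{x}}$ be the bar involution of $\mathbb T_n$, i.e. the additive map with $\overline{v_{\mathbf i^-_\gamma}}=v_{\mathbf i^-_\gamma}$, $\overline{q^mx}=q^{-m}\overline x$, $\overline{xH_k}=\overline xH_k^{-1}$; an element $\eta\in\mathcal S_q(n)$ is called bar invariant if $\overline{\eta(v_{\mathbf i^-_\nu})}=\eta(v_{\mathbf i^-_\nu})$ for all $\nu\in\Lambda_n$. The canonical basis element $\{\phi^g_{\gamma\nu}\}$ is the unique bar invariant element of $[\phi^g_{\gamma\nu}]+\sum_{y<g}q\mathbb Z[q]\,[\phi^y_{\gamma\nu}]$, where $y$ runs over minimal length representatives of the double cosets in $W_\gamma\backslash W/W_\nu$. Define, for $0\le a<n$, $$e_a=\sum_{k=0}^n\{\phi^{1}_{\varepsilon_a+\varepsilon_k,\,\varepsilon_{a+1}+\varepsilon_k}\},\qquad f_a=\sum_{k=0}^n\{\phi^{1}_{\varepsilon_{a+1}+\varepsilon_k,\,\varepsilon_a+\varepsilon_k}\},$$ $$t=\sum_{0<k+1<l\le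 n}\{\phi^{1}_{\varepsilon_k+\varepsilon_l,\,\varepsilon_k+\varepsilon_l}\}+\sum_{k=0}^{n-1}\{\phi^{s_1}_{\varepsilon_k+\varepsilon_{k+1},\,\varepsilon_k+\varepsilon_{k+1}}\}.$$ Then the unital $\mathbb Q(q)$-algebra $\mathcal S_q(n)_{\mathbb Q}$ is generated by $e_a,f_a$ $(0\le a<n)$ and $t$. Moreover, let $\mathbb T_n^1=\bigoplus_{\mathbf i\in\bar X_n}\mathbb Zv_{\mathbf i}$ with the right $W$-action $v_{\mathbf i}\cdot w=v_{\mathbf i\cdot w}$, let $\mathcal S(n)=\mathrm{End}_W(\mathbb T_n^1)$, and $\mathcal S(n)_{\mathbb Q}=\mathbb Q\otimes_{\mathbb Z}\mathcal S(n)$. Then the unital $\mathbb Q$-algebra $\mathcal S(n)_{\mathbb Q}$ is generated by the specializations at $q=1$ of $e_a,f_a$ $(0\le a<n)$ and $t$, i.e. the elements of $\mathcal S(n)$ whose matrix coefficients in the basis $v_{\mathbf i}$ are those of $e_a,f_a,t$ evaluated at $q=1$. -/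

import Mathlib

open scoped TensorProduct LaurentPolynomial

namespace G2Schur

/-! ### The Weyl group of type `G₂` and its action on weights -/

/-- The Weyl group of type `G₂`, realised as the group `S₃ × {±1}` of signed permutations of the
coordinates of `ℤ³` (permutation of the three coordinates, together with a global sign). -/
abbrev W : Type := Equiv.Perm (Fin 3) × ℤˣ

/-- The simple reflections: `s 0` is `s₁ : (a,b,c) ↦ (b,a,c)` and `s 1` is
`s₂ : (a,b,c) ↦ (-a,-c,-b)`. -/
def s : Fin 2 → W := ![(Equiv.swap 0 1, 1), (Equiv.swap 1 2, -1)]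

/-- `s₁` and `s₂` generate `W`. -/
theorem closure_s : Subgroup.closure (Set.range s) = ⊤ := by
  have h : ∀ w : W, ∃ k : Fin 6, w = (s 0 * s 1) ^ (k : ℕ) ∨ w = (s 0 * s 1) ^ (k : ℕ) * s 0 := by
    decide
  rw [eq_top_iff]
  intro w _
  have h0 : s 0 ∈ Subgroup.closure (Set.range s) := Subgroup.subset_closure ⟨0, rfl⟩
  have h1 : s 1 ∈ Subgroup.closure (Set.range s) := Subgroup.subset_closure ⟨1, rfl⟩
  obtain ⟨k, rfl | rfl⟩ := h w
  · exact Subgroup.pow_mem _ (Subgroup.mul_mem _ h0 h1) _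
  · exact Subgroup.mul_mem _ (Subgroup.pow_mem _ (Subgroup.mul_mem _ h0 h1) _) h0

/-- The length `ℓ(w)`: the least length of a word in `s₁, s₂` with product `w`. -/
noncomputable def len (w : W) : ℕ :=
  sInf {m : ℕ | ∃ l : List (Fin 2), l.length = m ∧ (l.map s).prod = w}

/-- The (`ρ`-shifted) weights `(a,b,c) ∈ ℤ³`, `a + b + c = 0`. -/
def Wt : Type := {i : Fin 3 → ℤ // i 0 + i 1 + i 2 = 0}

/-- The natural (left) action of `W` on weights. -/
instance : MulAction W Wt where
  smul w i := ⟨fun k => (w.2 : ℤ) * i.1 (w.1⁻¹ k), by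
    have h := Equiv.sum_comp w.1⁻¹ i.1
    simp only [Fin.sum_univ_three] at h
    rw [← mul_add, ← mul_add, h, i.2, mul_zero]⟩
  one_smul i := Subtype.ext (funext fun k => by
    change ((1 : ℤˣ) : ℤ) * i.1 ((1 : Equiv.Perm (Fin 3))⁻¹ k) = i.1 k
    simp)
  mul_smul w w' i := Subtype.ext (funext fun k => by
    change ((w.2 * w'.2 : ℤˣ) : ℤ) * i.1 ((w.1 * w'.1)⁻¹ k) =
      (w.2 : ℤ) * ((w'.2 : ℤ) * i.1 (w'.1⁻¹ (w.1⁻¹ k)))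
    simp [mul_assoc])

/-- The set `Λ_n` of `ε`-weights `ε_a + ε_b`, `0 ≤ a, b ≤ n`: the unordered pair `s(a, b)` stands
for `ε_a + ε_b`. -/
abbrev Lam (n : ℕ) : Type := Sym2 (Fin (n + 1))

/-- The anti-dominant weight `(a, b, -a-b)`, `0 ≤ a ≤ b`, of `ε`-weight `ε_a + ε_b`. -/
def antiWt {n : ℕ} (γ : Lam n) : Wt :=
  ⟨![(γ.inf : ℕ), (γ.sup : ℕ), -(γ.inf : ℕ) - (γ.sup : ℕ)], by
    simp only [Matrix.cons_val_zero, Matrix.cons_val_one, Matrix.cons_val]; ring⟩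

/-- The finite set of weights lying in the linkage class (`W`-orbit) of some `(a, b, -a-b)` with
`0 ≤ a ≤ b ≤ n`. -/
def X (n : ℕ) : Type := {i : Wt // ∃ (γ : Lam n) (w : W), i = w • antiWt γ}

instance (n : ℕ) : MulAction W (X n) where
  smul w i := ⟨w • i.1, by
    obtain ⟨γ, u, h⟩ := i.2
    exact ⟨γ, w * u, by rw [h, mul_smul]⟩⟩
  one_smul i := Subtype.ext (one_smul W i.1)
  mul_smul w w' i := Subtype.ext (mul_smul w w' i.1)

/-- The right action `i · w = w⁻¹(i)` of `W`. -/
def X.ract {n : ℕ} (i : X n) (w : W) : X n := w⁻¹ • i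

/-- The unique anti-dominant weight in the linkage class `γ`. -/
def anti {n : ℕ} (γ : Lam n) : X n := ⟨antiWt γ, γ, 1, (one_smul W _).symm⟩

/-! ### The Hecke algebra and the `q`-Schur algebra -/

/-- The ring `𝒜 = ℤ[q, q⁻¹]`. -/
abbrev A : Type := ℤ[T;T⁻¹]

/-- The power `q ^ m` in `ℤ[q, q⁻¹]`. -/
noncomputable def q (m : ℤ) : A := LaurentPolynomial.T m

/-- The defining relations of the Hecke algebra of type `G₂`. -/
inductive HeckeRel : FreeAlgebra A (Fin 2) → FreeAlgebra A (Fin 2) → Prop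
  | quad (k : Fin 2) : HeckeRel
      ((FreeAlgebra.ι A k - algebraMap A _ (q (-1))) * (FreeAlgebra.ι A k + algebraMap A _ (q 1))) 0
  | braid : HeckeRel
      ((FreeAlgebra.ι A 0 * FreeAlgebra.ι A 1) ^ 3) ((FreeAlgebra.ι A 1 * FreeAlgebra.ι A 0) ^ 3)

/-- The Hecke algebra of type `G₂` over `𝒜`. -/
abbrev Hecke : Type := RingQuot HeckeRel

/-- The generators of the Hecke algebra. -/
noncomputable def Hecke.gen (k : Fin 2) : Hecke :=
  RingQuot.mkAlgHom A HeckeRel (FreeAlgebra.ι A k)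

/-- The free `𝒜`-module `𝕋_n` with basis `v_i`, `i ∈ X n`. -/
abbrev Tn (n : ℕ) : Type := X n →₀ A

/-- The standard basis element `v_i`. -/
noncomputable def v {n : ℕ} (i : X n) : Tn n := Finsupp.single i 1

/-- The integer `m` with `i · s_k = i + m α_k`, for `i = (a,b,c)`: it is `b - a` for `k = 0` and
`a` for `k = 1` (here `α₁ = (1,-1,0)` and `α₂ = (-2,1,1)`). -/
def height (k : Fin 2) {n : ℕ} (i : X n) : ℤ := ![i.1.1 1 - i.1.1 0, i.1.1 0] k

/-- The action of the `k`-th Hecke generator on `𝕋_n`. -/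
noncomputable def heckeOp (n : ℕ) (k : Fin 2) : Module.End A (Tn n) :=
  Finsupp.linearCombination A fun i =>
    if height k i = 0 then q (-1) • v i
    else if 0 < height k i then v (i.ract (s k))
    else v (i.ract (s k)) + (q (-1) - q 1) • v i

theorem heckeOp_v {n : ℕ} (k : Fin 2) (i : X n) : heckeOp n k (v i) =
    if height k i = 0 then q (-1) • v i
    else if 0 < height k i then v (i.ract (s k))
    else v (i.ract (s k)) + (q (-1) - q 1) • v i := by
  simp [heckeOp, v]

theorem height_zero {n : ℕ} (i : X n) : height 0 i = i.1.1 1 - i.1.1 0 := rfl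

theorem height_one {n : ℕ} (i : X n) : height 1 i = i.1.1 0 := rfl

theorem ract_zero_val {n : ℕ} (i : X n) :
    (i.ract (s 0)).1.1 = ![i.1.1 1, i.1.1 0, i.1.1 2] := by
  funext k
  change (((s 0)⁻¹ : W).2 : ℤ) * i.1.1 (((s 0)⁻¹ : W).1⁻¹ k) = _
  fin_cases k <;> simp [s, Equiv.swap_apply_def]

theorem ract_one_val {n : ℕ} (i : X n) :
    (i.ract (s 1)).1.1 = ![-i.1.1 0, -i.1.1 2, -i.1.1 1] := by
  funext k
  change (((s 1)⁻¹ : W).2 : ℤ) * i.1.1 (((s 1)⁻¹ : W).1⁻¹ k) = _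
  fin_cases k <;> simp [s, Equiv.swap_apply_def]

theorem wt_ext {n : ℕ} {i j : X n} (h0 : i.1.1 0 = j.1.1 0) (h1 : i.1.1 1 = j.1.1 1) : i = j := by
  apply Subtype.ext
  apply Subtype.ext
  funext k
  have hi := i.1.2
  have hj := j.1.2
  fin_cases k
  · exact h0
  · exact h1
  · change i.1.1 2 = j.1.1 2
    omega

theorem ract_eq_self {n : ℕ} (k : Fin 2) (i : X n) (h : height k i = 0) : i.ract (s k) = i := by
  have hi := i.1.2
  fin_cases k
  · change i.1.1 1 - i.1.1 0 = 0 at h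
    apply wt_ext
    · change (i.ract (s 0)).1.1 0 = _
      rw [ract_zero_val]; simp; omega
    · change (i.ract (s 0)).1.1 1 = _
      rw [ract_zero_val]; simp; omega
  · change i.1.1 0 = 0 at h
    apply wt_ext
    · change (i.ract (s 1)).1.1 0 = _
      rw [ract_one_val]; simp; omega
    · change (i.ract (s 1)).1.1 1 = _
      rw [ract_one_val]; simp; omega

theorem height_00 {n : ℕ} (i : X n) : height 0 (i.ract (s 0)) = -height 0 i := by
  rw [height_zero, height_zero, ract_zero_val]; simp

theorem height_10 {n : ℕ} (i : X n) : height 1 (i.ract (s 0)) = height 0 i + height 1 i := by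
  rw [height_zero, height_one, height_one, ract_zero_val]; simp

theorem height_11 {n : ℕ} (i : X n) : height 1 (i.ract (s 1)) = -height 1 i := by
  rw [height_one, height_one, ract_one_val]; simp

theorem height_01 {n : ℕ} (i : X n) : height 0 (i.ract (s 1)) = height 0 i + 3 * height 1 i := by
  have hi := i.1.2
  rw [height_zero, height_zero, height_one, ract_one_val]; simp; omega

theorem ract_ract {n : ℕ} (i : X n) (w w' : W) : (i.ract w).ract w' = i.ract (w * w') := by
  simp only [X.ract, mul_inv_rev, mul_smul]

theorem ract_s_s {n : ℕ} (k : Fin 2) (i : X n) : (i.ract (s k)).ract (s k) = i := by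
  rw [ract_ract, show s k * s k = 1 by fin_cases k <;> decide]
  simp [X.ract]

theorem height_s {n : ℕ} (k : Fin 2) (i : X n) : height k (i.ract (s k)) = -height k i := by
  fin_cases k
  · exact height_00 i
  · exact height_11 i

theorem heckeOp_zero {n : ℕ} (k : Fin 2) (i : X n) (h : height k i = 0) :
    heckeOp n k (v i) = q (-1) • v i := by
  rw [heckeOp_v, if_pos h]

theorem heckeOp_pos {n : ℕ} (k : Fin 2) (i : X n) (h : 0 < height k i) :
    heckeOp n k (v i) = v (i.ract (s k)) := by
  rw [heckeOp_v, if_neg h.ne', if_pos h]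

theorem heckeOp_neg {n : ℕ} (k : Fin 2) (i : X n) (h : height k i < 0) :
    heckeOp n k (v i) = v (i.ract (s k)) + (q (-1) - q 1) • v i := by
  rw [heckeOp_v, if_neg h.ne, if_neg h.le.not_gt]

theorem q_mul (a b : ℤ) : q a * q b = q (a + b) := (LaurentPolynomial.T_add a b).symm

theorem q_zero : q 0 = 1 := LaurentPolynomial.T_zero

theorem Tn_induction {n : ℕ} {η θ : Module.End A (Tn n)} (h : ∀ i, η (v i) = θ (v i)) : η = θ := by
  apply Finsupp.lhom_ext
  intro i b
  have : (Finsupp.single i b : Tn n) = b • v i := by simp [v]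
  rw [this, map_smul, map_smul, h]

theorem heckeOp_sq (n : ℕ) (k : Fin 2) (x : Tn n) :
    heckeOp n k (heckeOp n k x) = x + (q (-1) - q 1) • heckeOp n k x := by
  have : heckeOp n k * heckeOp n k = 1 + (q (-1) - q 1) • heckeOp n k := by
    apply Tn_induction
    intro i
    change heckeOp n k (heckeOp n k (v i)) = v i + (q (-1) - q 1) • heckeOp n k (v i)
    rcases lt_trichotomy (height k i) 0 with h | h | h
    · rw [heckeOp_neg k i h, map_add, map_smul, heckeOp_pos k (i.ract (s k)) (by
        rw [height_s]; omega), ract_s_s, heckeOp_neg k i h]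
    · rw [heckeOp_zero k i h, map_smul, heckeOp_zero k i h, smul_smul, smul_smul, sub_mul, q_mul,
        q_mul, sub_smul]
      simp [q_zero]
    · rw [heckeOp_pos k i h, heckeOp_neg k (i.ract (s k)) (by rw [height_s]; omega), ract_s_s]
  exact LinearMap.congr_fun this x

theorem heckeOp_quad (n : ℕ) (k : Fin 2) :
    (heckeOp n k + algebraMap A _ (q 1)) * (heckeOp n k - algebraMap A _ (q (-1))) = 0 := by
  apply LinearMap.ext
  intro x
  change heckeOp n k (heckeOp n k x - q (-1) • x) + q 1 • (heckeOp n k x - q (-1) • x) = 0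
  rw [map_sub, heckeOp_sq, map_smul, smul_sub, smul_smul, q_mul]
  simp only [add_neg_cancel, q_zero]
  module

theorem X_induction {n : ℕ} {p : X n → Prop} (h0 : ∀ γ, p (anti γ))
    (hs : ∀ k i, p i → p (i.ract (s k))) (i : X n) : p i := by
  have key : ∀ w : W, ∀ j : X n, p j → p (w • j) := by
    intro w
    have hw : w ∈ Subgroup.closure (Set.range s) := by rw [closure_s]; trivial
    have hinv : ∀ k, (s k)⁻¹ = s k := by decide
    induction hw using Subgroup.closure_induction with
    | mem x hx =>
      obtain ⟨k, rfl⟩ := hx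
      intro j hj
      have := hs k j hj
      rwa [X.ract, hinv] at this
    | one => intro j hj; rwa [one_smul]
    | mul x y _ _ hx hy => intro j hj; rw [mul_smul]; exact hx _ (hy _ hj)
    | inv x hxm hx =>
      intro j hj
      have hfin : x ^ (Fintype.card W) = 1 := pow_card_eq_one
      have hpow : ∀ (m : ℕ) (j : X n), p j → p (x ^ m • j) := by
        intro m
        induction m with
        | zero => intro j hj; rwa [pow_zero, one_smul]
        | succ m ih => intro j hj; rw [pow_succ, mul_smul]; exact ih _ (hx _ hj)
      have : x⁻¹ = x ^ (Fintype.card W - 1) := by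
        rw [inv_eq_iff_mul_eq_one, ← pow_succ', Nat.sub_add_cancel Fintype.card_pos, hfin]
      rw [this]
      exact hpow _ _ hj
  obtain ⟨γ, w, h⟩ := i.2
  have : i = w • anti γ := Subtype.ext h
  rw [this]
  exact key w _ (h0 γ)

theorem braid_stable {n : ℕ} {P Q : Module.End A (Tn n)} {p : A}
    (hP : ∀ x, P (P x) = x + p • P x)
    {x : Tn n} (h : Q (P (Q (P (Q (P x))))) = P (Q (P (Q (P (Q x)))))) :
    Q (P (Q (P (Q (P (P x)))))) = P (Q (P (Q (P (Q (P x)))))) := by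
  rw [h, hP x, hP (Q (P (Q (P (Q x)))))]
  simp only [map_add, map_smul]
  rw [h]

theorem anti_height {n : ℕ} (γ : Lam n) (k : Fin 2) : 0 ≤ height k (anti γ) := by
  have h : (γ.inf : ℕ) ≤ (γ.sup : ℕ) := by
    induction γ using Sym2.ind with
    | _ a b => exact Fin.le_def.mp (inf_le_sup (a := a) (b := b))
  fin_cases k
  · change (0 : ℤ) ≤ ((γ.sup : ℕ) : ℤ) - ((γ.inf : ℕ) : ℤ)
    omega
  · change (0 : ℤ) ≤ ((γ.inf : ℕ) : ℤ)
    omega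

theorem braid_anti {n : ℕ} (i : X n) (h0 : 0 ≤ height 0 i) (h1 : 0 ≤ height 1 i) :
    heckeOp n 1 (heckeOp n 0 (heckeOp n 1 (heckeOp n 0 (heckeOp n 1 (heckeOp n 0 (v i)))))) =
    heckeOp n 0 (heckeOp n 1 (heckeOp n 0 (heckeOp n 1 (heckeOp n 0 (heckeOp n 1 (v i)))))) := by
  have hw : (((((i.ract (s 0)).ract (s 1)).ract (s 0)).ract (s 1)).ract (s 0)).ract (s 1) =
      (((((i.ract (s 1)).ract (s 0)).ract (s 1)).ract (s 0)).ract (s 1)).ract (s 0) := by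
    simp only [ract_ract]
    congr 1
    decide
  rcases h0.eq_or_lt with h0 | h0 <;> rcases h1.eq_or_lt with h1 | h1
  · simp (disch := ((try simp only [height_00, height_01, height_10, height_11]); omega)) only
      [heckeOp_zero, map_smul]
  · simp (disch := ((try simp only [height_00, height_01, height_10, height_11]); omega)) only
      [heckeOp_zero, heckeOp_pos, map_smul]
  · simp (disch := ((try simp only [height_00, height_01, height_10, height_11]); omega)) only
      [heckeOp_zero, heckeOp_pos, map_smul]
  · simp (disch := ((try simp only [height_00, height_01, height_10, height_11]); omega)) only
      [heckeOp_pos, hw]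

theorem braid_v {n : ℕ} (i : X n) :
    heckeOp n 1 (heckeOp n 0 (heckeOp n 1 (heckeOp n 0 (heckeOp n 1 (heckeOp n 0 (v i)))))) =
    heckeOp n 0 (heckeOp n 1 (heckeOp n 0 (heckeOp n 1 (heckeOp n 0 (heckeOp n 1 (v i)))))) := by
  induction i using X_induction with
  | h0 γ => exact braid_anti _ (anti_height γ 0) (anti_height γ 1)
  | hs k i h =>
    have hk : ∀ k, heckeOp n 1 (heckeOp n 0 (heckeOp n 1 (heckeOp n 0 (heckeOp n 1 (heckeOp n 0
          (heckeOp n k (v i))))))) =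
        heckeOp n 0 (heckeOp n 1 (heckeOp n 0 (heckeOp n 1 (heckeOp n 0 (heckeOp n 1
          (heckeOp n k (v i))))))) := by
      have a0 := braid_stable (P := heckeOp n 0) (Q := heckeOp n 1) (heckeOp_sq n 0) h
      have a1 := braid_stable (P := heckeOp n 1) (Q := heckeOp n 0) (heckeOp_sq n 1) h.symm
      rw [Fin.forall_fin_two]
      exact ⟨a0, a1.symm⟩
    rcases lt_trichotomy (height k i) 0 with h' | h' | h'
    · have e : v (i.ract (s k)) = heckeOp n k (v i) - (q (-1) - q 1) • v i := by
        rw [heckeOp_neg k i h']; abel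
      rw [e]
      simp only [map_sub, map_smul]
      rw [h, hk k]
    · rwa [ract_eq_self k i h']
    · rw [← heckeOp_pos k i h']
      exact hk k

theorem heckeOp_braid (n : ℕ) :
    (heckeOp n 1 * heckeOp n 0) ^ 3 = (heckeOp n 0 * heckeOp n 1) ^ 3 := by
  apply Tn_induction
  intro i
  exact braid_v i

/-- The right action of the Hecke algebra on `𝕋_n`. -/
noncomputable def rightAction (n : ℕ) : Hecke →ₐ[A] (Module.End A (Tn n))ᵐᵒᵖ :=
  RingQuot.liftAlgHom A ⟨FreeAlgebra.lift A fun k => MulOpposite.op (heckeOp n k), by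
    intro x y h
    cases h with
    | quad k =>
      apply MulOpposite.unop_injective
      simpa using heckeOp_quad n k
    | braid =>
      apply MulOpposite.unop_injective
      simpa using heckeOp_braid n⟩

theorem rightAction_gen (n : ℕ) (k : Fin 2) :
    rightAction n (Hecke.gen k) = MulOpposite.op (heckeOp n k) := by
  simp [rightAction, Hecke.gen]

/-- The `q`-Schur algebra `𝒮_q(n) = End_ℋ(𝕋_n)`: the `𝒜`-linear endomorphisms of `𝕋_n` commuting
with the right action of the Hecke algebra. -/
noncomputable def Sq (n : ℕ) : Subalgebra A (Module.End A (Tn n)) :=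
  Subalgebra.centralizer A (Set.range fun h : Hecke => (rightAction n h).unop)

/-! ### The standard and the canonical basis of the `q`-Schur algebra -/

/-- The parabolic subgroup `W_γ`, generated by the simple reflections fixing the anti-dominant
weight of `γ`. -/
def parab {n : ℕ} (γ : Lam n) : Subgroup W :=
  Subgroup.closure {w | ∃ k : Fin 2, w = s k ∧ (anti γ).ract (s k) = anti γ}

/-- The double coset `W_γ g W_ν`. -/
def dcoset {n : ℕ} (γ : Lam n) (g : W) (ν : Lam n) : Set W :=
  {w | ∃ x ∈ parab γ, ∃ y ∈ parab ν, w = x * g * y}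

/-- The minimal length double coset representatives of `W_γ \ W / W_ν`. -/
def minRep {n : ℕ} (γ ν : Lam n) : Set W :=
  {g | ∀ w ∈ dcoset γ g ν, len g ≤ len w}

/-- The minimal length representatives of the cosets `W_γ w` contained in `W_γ g W_ν`. -/
def rightReps {n : ℕ} (γ : Lam n) (g : W) (ν : Lam n) : Set W :=
  {w | w ∈ dcoset γ g ν ∧ ∀ x ∈ parab γ, len w ≤ len (x * w)}

/-- The length of the longest element of a set of elements of `W`. -/
noncomputable def maxLen (S : Set W) : ℕ := sSup (len '' S)

open Classical in
/-- The element `φ_{γν}^g` of the `q`-Schur algebra: the `ℋ`-linear map which kills the generators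
`v_{i⁻}` of all linkage classes other than `ν` and sends the generator of the class `ν` to
`q^{ℓ(w_∘^ν)} H_{W_γ g W_ν}`, which under the identification of `𝕋_γ` with `x_γ ℋ` is
`q^{ℓ(w_∘^ν) - ℓ(w_∘^γ)} ∑_w q^{-ℓ(w)} v_{i⁻_γ · w}`, the sum being over the minimal length
representatives of the right cosets of `W_γ` in `W_γ g W_ν`. -/
noncomputable def phi {n : ℕ} (γ : Lam n) (g : W) (ν : Lam n) : Sq n :=
  Classical.epsilon fun f : Sq n => ∀ ν' : Lam n, (f : Module.End A (Tn n)) (v (anti ν')) =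
    if ν' = ν then
      q ((maxLen (parab ν) : ℤ) - maxLen (parab γ)) •
        ∑ w ∈ Finset.univ.filter (· ∈ rightReps γ g ν), q (-(len w : ℤ)) • v ((anti γ).ract w)
    else 0

/-- The standard basis element `[φ_{γν}^g] = q^{ℓ(g⁺) - ℓ(w_∘^ν)} φ_{γν}^g`, where `g⁺` is the
longest element of `W_γ g W_ν`. -/
noncomputable def std {n : ℕ} (γ : Lam n) (g : W) (ν : Lam n) : Sq n :=
  q ((maxLen (dcoset γ g ν) : ℤ) - maxLen (parab ν)) • phi γ g ν

/-- The characterising properties of the bar involution of `𝕋_n`: it is additive, semilinear for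
`q ↦ q⁻¹`, fixes `v_i` for anti-dominant `i`, and satisfies `bar (x H_k) = bar x * H_k⁻¹`. -/
def IsBar {n : ℕ} (β : Tn n →+ Tn n) : Prop :=
  (∀ (p : A) (x : Tn n), β (p • x) = LaurentPolynomial.invert p • β x) ∧
  (∀ γ : Lam n, β (v (anti γ)) = v (anti γ)) ∧
  (∀ (k : Fin 2) (x : Tn n), heckeOp n k (β (heckeOp n k x)) = β x)

/-- The bar involution of `𝕋_n`. -/
noncomputable def bar (n : ℕ) : Tn n →+ Tn n := Classical.epsilon IsBar

/-- Bar-invariance of `f ∈ 𝒮_q(n)`: the bar conjugate of `f` is the `ℋ`-linear map which takes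
the value `bar (f x)` at the anti-dominant generators `x` of `𝕋_n`. -/
def BarInvariant {n : ℕ} (f : Sq n) : Prop :=
  ∀ ν : Lam n, bar n ((f : Module.End A (Tn n)) (v (anti ν))) =
    (f : Module.End A (Tn n)) (v (anti ν))

open Classical in
/-- The canonical basis element `{φ_{γν}^g}`: the bar-invariant element of
`[φ_{γν}^g] + ∑_{y < g} q ℤ[q] [φ_{γν}^y]`, with `y` running over the minimal length double coset
representatives. In type `G₂` one has `y < g` in the Bruhat order exactly when `ℓ(y) < ℓ(g)`. -/
noncomputable def can {n : ℕ} (γ : Lam n) (g : W) (ν : Lam n) : Sq n :=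
  Classical.epsilon fun f : Sq n => BarInvariant f ∧ ∃ p : W → Polynomial ℤ,
    f = std γ g ν + ∑ y ∈ Finset.univ.filter (fun y => y ∈ minRep γ ν ∧ len y < len g),
      Polynomial.toLaurent (Polynomial.X * p y) • std γ y ν

/-- `e_a = ∑_{k=0}^n {φ^1_{ε_a+ε_k, ε_{a+1}+ε_k}}`, `0 ≤ a < n`. -/
noncomputable def e (n : ℕ) (a : Fin n) : Sq n :=
  ∑ k : Fin (n + 1), can s(a.castSucc, k) 1 s(a.succ, k)

/-- `f_a = ∑_{k=0}^n {φ^1_{ε_{a+1}+ε_k, ε_a+ε_k}}`, `0 ≤ a < n`. -/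
noncomputable def f (n : ℕ) (a : Fin n) : Sq n :=
  ∑ k : Fin (n + 1), can s(a.succ, k) 1 s(a.castSucc, k)

/-- `t = ∑_{0 < k+1 < l ≤ n} {φ^1_{ε_k+ε_l, ε_k+ε_l}}
  + ∑_{k=0}^{n-1} {φ^{s₁}_{ε_k+ε_{k+1}, ε_k+ε_{k+1}}}`. -/
noncomputable def t (n : ℕ) : Sq n :=
  (∑ k : Fin (n + 1), ∑ l : Fin (n + 1), if (k : ℕ) + 1 < l then can s(k, l) 1 s(k, l) else 0) +
    ∑ k : Fin n, can s(k.castSucc, k.succ) (s 0) s(k.castSucc, k.succ)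

/-! ### The specialization at `q = 1` -/

/-- The free abelian group `𝕋_n^1` with basis `v_i`, `i ∈ X n`. -/
abbrev Tn1 (n : ℕ) : Type := X n →₀ ℤ

/-- The right action `v_i · w = v_{i · w}` of `W` on `𝕋_n^1`. -/
noncomputable def weylOp (n : ℕ) (w : W) : Module.End ℤ (Tn1 n) :=
  Finsupp.lmapDomain ℤ ℤ fun i : X n => i.ract w

/-- The Schur algebra `𝒮(n) = End_W(𝕋_n^1)` over `ℤ`. -/
noncomputable def S1 (n : ℕ) : Subalgebra ℤ (Module.End ℤ (Tn1 n)) :=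
  Subalgebra.centralizer ℤ (Set.range (weylOp n))

/-- Evaluation of Laurent polynomials at `q = 1`. -/
noncomputable def evalOne : A →+* ℤ := LaurentPolynomial.eval₂ (RingHom.id ℤ) 1

/-- The specialization `𝕋_n → 𝕋_n^1` at `q = 1`. -/
noncomputable def specT {n : ℕ} : Tn n →+ Tn1 n :=
  Finsupp.mapRange.addMonoidHom evalOne.toAddMonoidHom

/-- The specialization at `q = 1` of an `𝒜`-linear endomorphism of `𝕋_n`, obtained by evaluating
its matrix coefficients in the standard basis at `q = 1`. -/
noncomputable def specEnd {n : ℕ} (η : Module.End A (Tn n)) : Module.End ℤ (Tn1 n) :=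
  Finsupp.linearCombination ℤ fun i => specT (η (v i))

theorem specT_smul {n : ℕ} (p : A) (x : Tn n) : specT (p • x) = evalOne p • specT x := by
  ext i
  simp [specT]

theorem specT_v {n : ℕ} (i : X n) : specT (v i) = Finsupp.single i 1 := by
  simp [specT, v]

theorem specEnd_specT {n : ℕ} (η : Module.End A (Tn n)) (x : Tn n) :
    specEnd η (specT x) = specT (η x) := by
  induction x using Finsupp.induction_linear with
  | zero => simp
  | add x y hx hy => simp only [map_add, hx, hy]
  | single i b =>
    have : (Finsupp.single i b : Tn n) = b • v i := by simp [v]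
    rw [this, specT_smul, map_smul, map_smul, specT_smul, specT_v]
    simp [specEnd]

theorem evalOne_q (m : ℤ) : evalOne (q m) = 1 := by
  simp [evalOne, q]

theorem specT_heckeOp {n : ℕ} (k : Fin 2) (x : Tn n) :
    specT (heckeOp n k x) = weylOp n (s k) (specT x) := by
  induction x using Finsupp.induction_linear with
  | zero => simp
  | add x y hx hy => simp only [map_add, hx, hy]
  | single i b =>
    have : (Finsupp.single i b : Tn n) = b • v i := by simp [v]
    have h : specT (heckeOp n k (v i)) = specT (v (i.ract (s k))) := by
      rcases lt_trichotomy (height k i) 0 with h | h | h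
      · rw [heckeOp_neg k i h, map_add, specT_smul, map_sub, evalOne_q, evalOne_q]
        simp
      · rw [heckeOp_zero k i h, specT_smul, evalOne_q, one_smul, ract_eq_self k i h]
      · rw [heckeOp_pos k i h]
    rw [this, map_smul, specT_smul, specT_smul, map_smul, h, specT_v, specT_v]
    simp [weylOp, Finsupp.lmapDomain_apply]

theorem specEnd_mem {n : ℕ} (η : Sq n) : specEnd (η : Module.End A (Tn n)) ∈ S1 n := by
  have hs : ∀ (k : Fin 2) (y : Tn1 n),
      weylOp n (s k) (specEnd η.1 y) = specEnd η.1 (weylOp n (s k) y) := by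
    intro k y
    have hη : heckeOp n k * η.1 = η.1 * heckeOp n k := by
      have := (Subalgebra.mem_centralizer_iff A).mp η.2 (heckeOp n k)
        ⟨Hecke.gen k, by simp only [rightAction_gen, MulOpposite.unop_op]⟩
      exact this
    induction y using Finsupp.induction_linear with
    | zero => simp
    | add x y hx hy => simp only [map_add, hx, hy]
    | single i b =>
      have : (Finsupp.single i b : Tn1 n) = b • specT (v i) := by simp [specT_v]
      rw [this, map_smul, map_smul, map_smul, map_smul, specEnd_specT, ← specT_heckeOp,
        ← specT_heckeOp, specEnd_specT]
      congr 2
      exact LinearMap.congr_fun hη (v i)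
  have hmul : ∀ (w w' : W) (y : Tn1 n), weylOp n (w * w') y = weylOp n w' (weylOp n w y) := by
    intro w w' y
    simp only [weylOp, Finsupp.lmapDomain_apply, ← Finsupp.mapDomain_comp]
    congr 1
    funext i
    exact (ract_ract i w w').symm
  have hone : ∀ y : Tn1 n, weylOp n 1 y = y := by
    intro y
    have : (fun i : X n => i.ract 1) = id := by funext i; simp [X.ract]
    simp only [weylOp, Finsupp.lmapDomain_apply, this, Finsupp.mapDomain_id]
  refine (Subalgebra.mem_centralizer_iff ℤ).mpr ?_
  rintro _ ⟨w, rfl⟩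
  apply LinearMap.ext
  have hw : w ∈ Subgroup.closure (Set.range s) := by rw [closure_s]; trivial
  induction hw using Subgroup.closure_induction with
  | mem x hx =>
    obtain ⟨k, rfl⟩ := hx
    exact hs k
  | one =>
    intro y
    change weylOp n 1 _ = specEnd η.1 (weylOp n 1 y)
    rw [hone, hone]
  | mul x y _ _ hx hy =>
    intro z
    change weylOp n (x * y) (specEnd η.1 z) = specEnd η.1 (weylOp n (x * y) z)
    have hx' : ∀ z, weylOp n x (specEnd η.1 z) = specEnd η.1 (weylOp n x z) := hx
    have hy' : ∀ z, weylOp n y (specEnd η.1 z) = specEnd η.1 (weylOp n y z) := hy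
    rw [hmul, hmul, hx', hy']
  | inv x _ hx =>
    intro z
    change weylOp n x⁻¹ (specEnd η.1 z) = specEnd η.1 (weylOp n x⁻¹ z)
    have hx' : ∀ z, weylOp n x (specEnd η.1 z) = specEnd η.1 (weylOp n x z) := hx
    have h1 : weylOp n x (weylOp n x⁻¹ z) = z := by rw [← hmul, inv_mul_cancel, hone]
    conv_lhs => rw [← h1, ← hx', ← hmul, mul_inv_cancel, hone]

/-- The specialization map `𝒮_q(n) → 𝒮(n)` at `q = 1`. -/
noncomputable def spec {n : ℕ} (η : Sq n) : S1 n := ⟨specEnd η.1, specEnd_mem η⟩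

/-- The field `ℚ(q)`, as the fraction field of `𝒜 = ℤ[q, q⁻¹]`. -/
abbrev Qq : Type := FractionRing A

end G2Schur

/-! The module `𝕋_n` is a direct sum of modules induced from parabolic subalgebras, one for each
block `γ : Lam n`. An element of `Sq n` is therefore determined by its values at the vectors `v
(anti γ)`, and every vector scaled by q⁻¹ under the generators of the stabilizer occurs as a value
(`exists_intertwiner`, `exists_Sq`). This turns the canonical basis elements in `e_a` and `f_a`, and
in `t` for n = 1, into explicit expressions in C_k = H_k + q applied to some `v (anti γ)`.

Call a simple reflection fixing `anti γ` a wall of the block γ. The generators `e_a`, `f_a` are sums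
of steps from blocks (j,k) to (i,k) with i, j neighbours, and a step times the opposite step is a
loop on (i,k) through (j,k). If every wall of (j,k) is a wall of (i,k), the loop is 1, [2] or [6]
times the block projection; the other loops needed act as C_0, C_1 or, for n = 1, C_1 C_0. A product
of loop sums at i ≠ i' lives in the single block (i,i'), which isolates the projections to blocks
with distant indices. For n ≥ 2, subtracting known loops and splitting sums of orthogonal
idempotents by squaring gives all projections (`proj_mem`), hence all steps. The block (1,2) has no
wall, and its endomorphisms are generated by two loops acting as C_0 and C_1 (`corner_mem`). Every
block projection factors, up to a scalar, through (1,2) (`link_all`), so everything is generated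
(`eq_top_of_link`). For n = 1 there is no block without walls: `t` separates the projections, and
`eq_top_one` replaces the corner argument. For n = 0 there is one block, and only scalars are
needed.

All scalars divided by are nonzero at q = 1. The argument thus applies to any `Saturated` subalgebra
over 𝒜, and both claims follow by applying it to the preimage of the generated algebra, the second
one with the help of `spec_surjective`. -/

namespace G2Schur

/-! ### Reduced words and parabolic subgroups -/

/-- A reduced word for each element of `W`. -/
def word (w : W) : List (Fin 2) :=
  -- The eleven listed words reach every element except the longest, which receives the default.
  ([[], [0], [1], [0, 1], [1, 0], [0, 1, 0], [1, 0, 1], [0, 1, 0, 1], [1, 0, 1, 0],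
    [0, 1, 0, 1, 0], [1, 0, 1, 0, 1]].find? fun l => (l.map s).prod = w).getD [0, 1, 0, 1, 0, 1]

theorem prod_word : ∀ w : W, ((word w).map s).prod = w := by decide

theorem length_word_s_mul : ∀ (k : Fin 2) (w : W),
    (word (s k * w)).length ≤ (word w).length + 1 := by decide

theorem length_word_prod_le (l : List (Fin 2)) : (word (l.map s).prod).length ≤ l.length := by
  induction l with
  | nil => decide
  | cons k l ih =>
    rw [List.map_cons, List.prod_cons, List.length_cons]
    exact (length_word_s_mul k _).trans (Nat.succ_le_succ ih)

theorem len_eq (w : W) : len w = (word w).length := by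
  apply le_antisymm
  · exact Nat.sInf_le ⟨word w, rfl, prod_word w⟩
  · refine le_csInf ⟨_, word w, rfl, prod_word w⟩ ?_
    rintro m ⟨l, rfl, rfl⟩
    exact length_word_prod_le l

/-- Only the longest element has two reduced words, which causes the second alternative; the braid
relation will identify the two. -/
theorem word_mul_s : ∀ (w : W) (k : Fin 2), (word w).length < (word (w * s k)).length →
    word (w * s k) = word w ++ [k] ∨
      (word (w * s k) = [0, 1, 0, 1, 0, 1] ∧ word w ++ [k] = [1, 0, 1, 0, 1, 0]) := by decide

theorem word_s_mul : ∀ (w : W) (k : Fin 2), (word w).length < (word (s k * w)).length →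
    word (s k * w) = k :: word w ∨
      (word (s k * w) = [0, 1, 0, 1, 0, 1] ∧ k :: word w = [1, 0, 1, 0, 1, 0]) := by decide

/-- The set underlying the standard parabolic subgroup of `W` generated by the `s k` for which
`b k` holds. -/
def Par (b : Fin 2 → Bool) (w : W) : Prop :=
  w = 1 ∨ (∃ k, b k ∧ w = s k) ∨ ∀ k, b k
instance (b : Fin 2 → Bool) : DecidablePred (Par b) := fun w => by unfold Par; infer_instance

theorem par_mul : ∀ b : Fin 2 → Bool, ∀ w w' : W, Par b w → Par b w' → Par b (w * w') := by
  decide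

theorem par_inv : ∀ b : Fin 2 → Bool, ∀ w : W, Par b w → Par b w⁻¹ := by
  decide

/-- The decidable form of the double coset `W_b g W_c`. -/
def Dcos (b : Fin 2 → Bool) (g : W) (c : Fin 2 → Bool) (w : W) : Prop :=
  ∃ x, Par b x ∧ Par c (g⁻¹ * (x * w))
instance (b : Fin 2 → Bool) (g : W) (c : Fin 2 → Bool) : DecidablePred (Dcos b g c) :=
  fun w => by unfold Dcos; infer_instance

/-- The finite set of minimal length representatives of the cosets `W_b w` in `W_b g W_c`. -/
def minReps (b : Fin 2 → Bool) (g : W) (c : Fin 2 → Bool) : Finset W :=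
  Finset.univ.filter fun w => Dcos b g c w ∧ ∀ x, Par b x → (word w).length ≤ (word (x * w)).length

/-- The maximal length of an element satisfying a decidable predicate. -/
def maxWord (p : W → Prop) [DecidablePred p] : ℕ :=
  (Finset.univ.filter p).sup fun w => (word w).length

theorem maxLen_eq (S : Set W) (p : W → Prop) [DecidablePred p] (h : ∀ w, w ∈ S ↔ p w) :
    maxLen S = maxWord p := by
  have hle : ∀ w ∈ S, len w ≤ maxWord p := fun w hw => by
    rw [len_eq]
    exact Finset.le_sup (f := fun w => (word w).length) (by simpa using (h w).mp hw)
  rcases S.eq_empty_or_nonempty with rfl | ⟨w₀, h₀⟩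
  · have hp : Finset.univ.filter p = ∅ := by
      ext w
      simpa using (not_congr (h w)).mp (Set.notMem_empty w)
    simp [maxLen, maxWord, hp]
  · apply le_antisymm
    · exact csSup_le ⟨_, w₀, h₀, rfl⟩ (by rintro _ ⟨w, hw, rfl⟩; exact hle w hw)
    · refine Finset.sup_le fun w hw => ?_
      rw [← len_eq]
      exact le_csSup ⟨maxWord p, by rintro _ ⟨w, hw, rfl⟩; exact hle w hw⟩
        ⟨w, (h w).mpr (by simpa using hw), rfl⟩

/-- Whether the simple reflection `s k` fixes the anti-dominant weight of `γ`. -/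
def fixes {n : ℕ} (γ : Lam n) (k : Fin 2) : Bool := decide (height k (anti γ) = 0)

theorem ract_s_eq_self_iff {n : ℕ} (i : X n) (k : Fin 2) :
    i.ract (s k) = i ↔ height k i = 0 := by
  refine ⟨fun h => ?_, ract_eq_self k i⟩
  have := height_s k i
  rw [h] at this
  omega

theorem mem_parab {n : ℕ} (γ : Lam n) (w : W) : w ∈ parab γ ↔ Par (fixes γ) w := by
  have hs : ∀ k, fixes γ k → s k ∈ parab γ := fun k hk =>
    Subgroup.subset_closure ⟨k, rfl, ract_eq_self k _ (by simpa [fixes] using hk)⟩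
  constructor
  · intro h
    induction h using Subgroup.closure_induction with
    | mem x hx =>
      obtain ⟨k, rfl, hk⟩ := hx
      exact Or.inr (Or.inl ⟨k, by simpa [fixes] using (ract_s_eq_self_iff _ _).mp hk, rfl⟩)
    | one => exact Or.inl rfl
    | mul x y _ _ hx hy => exact par_mul _ _ _ hx hy
    | inv x _ hx => exact par_inv _ _ hx
  · rintro (rfl | ⟨k, hk, rfl⟩ | h)
    · exact one_mem _
    · exact hs k hk
    · have : Subgroup.closure (Set.range s) ≤ parab γ :=
        (Subgroup.closure_le _).mpr (by rintro _ ⟨k, rfl⟩; exact hs k (h k))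
      exact this (by rw [closure_s]; trivial)

theorem mem_dcoset {n : ℕ} (γ : Lam n) (g : W) (ν : Lam n) (w : W) :
    w ∈ dcoset γ g ν ↔ Dcos (fixes γ) g (fixes ν) w := by
  constructor
  · rintro ⟨x, hx, y, hy, rfl⟩
    exact ⟨x⁻¹, par_inv _ _ ((mem_parab γ x).mp hx), by
      rw [show g⁻¹ * (x⁻¹ * (x * g * y)) = y by group]; exact (mem_parab ν y).mp hy⟩
  · rintro ⟨x, hx, hy⟩
    exact ⟨x⁻¹, (mem_parab γ _).mpr (par_inv _ _ hx), _, (mem_parab ν _).mpr hy, by group⟩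

theorem mem_rightReps {n : ℕ} (γ : Lam n) (g : W) (ν : Lam n) (w : W) :
    w ∈ rightReps γ g ν ↔ w ∈ minReps (fixes γ) g (fixes ν) := by
  simp [rightReps, minReps, mem_dcoset, mem_parab, len_eq]

/-- There are four standard parabolic subgroups in a group of order 12, so the coset combinatorics
is settled by enumeration. Here W_c ⊆ W_b, and the double coset of 1 is W_b. -/
theorem minReps_one : ∀ b c : Fin 2 → Bool, (∀ k, c k → b k) → minReps b 1 c = {1} := by decide

theorem maxWord_one : ∀ b c : Fin 2 → Bool, (∀ k, c k → b k) →
    maxWord (Dcos b 1 c) = maxWord (Par b) := by decide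

theorem minReps_pair : ∀ b c : Fin 2 → Bool, ∀ k, b k = false → (∀ j, c j ↔ j = k) →
    minReps b 1 c = {1, s k} := by decide

theorem maxWord_pair : ∀ b c : Fin 2 → Bool, ∀ k, b k = false → (∀ j, c j ↔ j = k) →
    maxWord (Dcos b 1 c) = maxWord (Par b) + 1 := by decide

theorem minReps_full : ∀ b c : Fin 2 → Bool, (∀ j, b j ↔ j = 1) → (∀ j, c j) →
    minReps b 1 c = {1, s 0, s 0 * s 1, s 0 * s 1 * s 0, s 0 * s 1 * s 0 * s 1,
      s 0 * s 1 * s 0 * s 1 * s 0} := by decide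

theorem maxWord_full : ∀ b c : Fin 2 → Bool, (∀ j, b j ↔ j = 1) → (∀ j, c j) →
    maxWord (Dcos b 1 c) = maxWord (Par b) + 5 := by decide

theorem minReps_s_wall : ∀ b : Fin 2 → Bool, (∀ j, b j ↔ j = 1) →
    minReps b (s 0) b = {s 0, s 0 * s 1} := by decide

theorem maxWord_s_wall : ∀ b : Fin 2 → Bool, (∀ j, b j ↔ j = 1) →
    maxWord (Dcos b (s 0) b) = maxWord (Par b) + 2 := by decide

theorem word_values : word 1 = [] ∧ (∀ k, word (s k) = [k]) ∧ word (s 0 * s 1) = [0, 1] ∧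
    word (s 0 * s 1 * s 0) = [0, 1, 0] ∧ word (s 0 * s 1 * s 0 * s 1) = [0, 1, 0, 1] ∧
    word (s 0 * s 1 * s 0 * s 1 * s 0) = [0, 1, 0, 1, 0] := by decide

/-! ### The universal property of `𝕋_n` -/

theorem words : ∀ w : W, w ∈ [1, s 0, s 1, s 0 * s 1, s 1 * s 0, s 0 * s 1 * s 0, s 1 * s 0 * s 1,
    s 0 * s 1 * s 0 * s 1, s 1 * s 0 * s 1 * s 0, s 0 * s 1 * s 0 * s 1 * s 0,
    s 1 * s 0 * s 1 * s 0 * s 1, s 0 * s 1 * s 0 * s 1 * s 0 * s 1] := by decide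

theorem descent_words : ∀ (w : W) (k : Fin 2), (word (w * s k)).length < (word w).length →
    (k = 0 ∧ w ∈ [s 0, s 1 * s 0, s 0 * s 1 * s 0, s 1 * s 0 * s 1 * s 0,
      s 0 * s 1 * s 0 * s 1 * s 0, s 0 * s 1 * s 0 * s 1 * s 0 * s 1]) ∨
    (k = 1 ∧ w ∈ [s 1, s 0 * s 1, s 1 * s 0 * s 1, s 0 * s 1 * s 0 * s 1,
      s 1 * s 0 * s 1 * s 0 * s 1, s 0 * s 1 * s 0 * s 1 * s 0 * s 1]) := by decide

theorem length_word_mul_s : ∀ (w : W) (k : Fin 2),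
    (word (w * s k)).length = (word w).length + 1 ∨
      (word w).length = (word (w * s k)).length + 1 := by decide

theorem length_word_s_mul' : ∀ (k : Fin 2) (w : W),
    (word (s k * w)).length = (word w).length + 1 ∨
      (word w).length = (word (s k * w)).length + 1 := by decide

theorem s_mul_s : ∀ k, s k * s k = 1 := by decide

theorem ract_one {n : ℕ} (i : X n) : i.ract 1 = i := by simp [X.ract]

/-- The height is the pairing with a simple coroot. A drop in length means that `w` carries this
coroot to a negative one, on which `j` is non-positive. -/
theorem height_ract_nonpos {n : ℕ} (j : X n) (hj : ∀ k, 0 ≤ height k j) (w : W) (k : Fin 2)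
    (h : (word (w * s k)).length < (word w).length) : height k (j.ract w) ≤ 0 := by
  have h0 := hj 0
  have h1 := hj 1
  rcases descent_words w k h with ⟨rfl, hw⟩ | ⟨rfl, hw⟩ <;>
    simp only [List.mem_cons, List.not_mem_nil, or_false] at hw <;>
    rcases hw with h | h | h | h | h | h <;>
    rw [h] <;> simp only [← ract_ract, height_00, height_01, height_10, height_11] <;> omega

theorem anti_eq_of_heights {n : ℕ} {γ ν : Lam n} (h : ∀ k, height k (anti γ) = height k (anti ν)) :
    γ = ν := by
  have h0 : (γ.sup : ℤ) - (γ.inf : ℕ) = (ν.sup : ℕ) - (ν.inf : ℕ) := h 0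
  have h1 : ((γ.inf : ℕ) : ℤ) = (ν.inf : ℕ) := h 1
  refine Sym2.inf_eq_inf_and_sup_eq_sup.mp ⟨Fin.ext ?_, Fin.ext ?_⟩ <;> omega

/-- The closed chamber meets each orbit only once. -/
theorem heights_ract_dominant {n : ℕ} (i j : X n) (hi : ∀ k, 0 ≤ height k i)
    (hj : ∀ k, 0 ≤ height k j) (w : W) (h : i.ract w = j) : ∀ k, height k i = height k j := by
  have i0 := hi 0
  have i1 := hi 1
  have j0 := hj 0
  have j1 := hj 1
  rw [Fin.forall_fin_two]
  subst h
  have hw := words w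
  simp only [List.mem_cons, List.not_mem_nil, or_false] at hw
  rcases hw with h | h | h | h | h | h | h | h | h | h | h | h <;> subst h <;>
    simp only [← ract_ract, ract_one, height_00, height_01, height_10, height_11, and_self] at j0 j1 ⊢ <;>
    omega

/-- The stabilizer of a point of the closed chamber is parabolic: an element of it other than 1 and
the simple reflections forces both heights to vanish. -/
theorem par_of_ract_eq {n : ℕ} (γ : Lam n) (w : W) (h : (anti γ).ract w = anti γ) :
    Par (fixes γ) w := by
  have i0 := anti_height γ 0
  have i1 := anti_height γ 1
  have h0 := congrArg (height 0) h
  have h1 := congrArg (height 1) h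
  have c0 : height 0 (anti γ) = 0 → fixes γ 0 := by simp [fixes]
  have c1 : height 1 (anti γ) = 0 → fixes γ 1 := by simp [fixes]
  have key : w = 1 ∨ (fixes γ 0 ∧ w = s 0) ∨ (fixes γ 1 ∧ w = s 1) ∨ (fixes γ 0 ∧ fixes γ 1) := by
    have hw := words w
    simp only [List.mem_cons, List.not_mem_nil, or_false] at hw
    rcases hw with h | h | h | h | h | h | h | h | h | h | h | h <;> subst h
    · exact Or.inl rfl
    · simp only [height_00] at h0
      exact Or.inr (Or.inl ⟨c0 (by omega), rfl⟩)
    · simp only [height_11] at h1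
      exact Or.inr (Or.inr (Or.inl ⟨c1 (by omega), rfl⟩))
    all_goals
      simp only [← ract_ract, height_00, height_01, height_10, height_11] at h0 h1
      exact Or.inr (Or.inr (Or.inr ⟨c0 (by omega), c1 (by omega)⟩))
  rcases key with h | h | h | h
  · exact Or.inl h
  · exact Or.inr (Or.inl ⟨0, h⟩)
  · exact Or.inr (Or.inl ⟨1, h⟩)
  · exact Or.inr (Or.inr (Fin.forall_fin_two.mpr h))

/-- The number of positive roots which are negative on `i`. -/
def depth {n : ℕ} (i : X n) : ℤ :=
  (if i.1.1 0 < 0 then 1 else 0) + (if i.1.1 1 < 0 then 1 else 0) +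
  (if 0 < i.1.1 2 then 1 else 0) + (if i.1.1 1 < i.1.1 0 then 1 else 0) +
  (if i.1.1 0 < i.1.1 2 then 1 else 0) + (if i.1.1 1 < i.1.1 2 then 1 else 0)

/-- The reflection `s k` permutes the positive roots other than the k-th simple one, so only the
contribution of that root changes. -/
theorem depth_ract_s {n : ℕ} (k : Fin 2) (i : X n) (h : 0 < height k i) :
    depth (i.ract (s k)) = depth i + 1 := by
  fin_cases k
  · change 0 < i.1.1 1 - i.1.1 0 at h
    change depth (i.ract (s 0)) = _
    simp only [depth, ract_zero_val, Matrix.cons_val_zero, Matrix.cons_val_one, Matrix.cons_val]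
    rw [if_pos (show i.1.1 0 < i.1.1 1 by omega), if_neg (show ¬ i.1.1 1 < i.1.1 0 by omega)]
    ring
  · change 0 < i.1.1 0 at h
    change depth (i.ract (s 1)) = _
    simp only [depth, ract_one_val, Matrix.cons_val_zero, Matrix.cons_val_one, Matrix.cons_val,
      neg_lt_neg_iff, Left.neg_neg_iff, Left.neg_pos_iff]
    rw [if_pos h, if_neg (show ¬ i.1.1 0 < 0 by omega)]
    ring

theorem depth_dominant {n : ℕ} (i : X n) (h : ∀ k, 0 ≤ height k i) : depth i = 0 := by
  have h0 : 0 ≤ i.1.1 1 - i.1.1 0 := h 0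
  have h1 : 0 ≤ i.1.1 0 := h 1
  have h2 := i.1.2
  unfold depth
  rw [if_neg (by omega), if_neg (by omega), if_neg (by omega), if_neg (by omega),
    if_neg (by omega), if_neg (by omega)]
  rfl

section Universal

variable {M : Type*} [AddCommGroup M] [Module A M]

/-- The product of the operators `P k` along a word. -/
noncomputable def wordOp (P : Fin 2 → Module.End A M) (l : List (Fin 2)) : Module.End A M :=
  l.foldl (fun F k => P k * F) 1

theorem wordOp_append (P : Fin 2 → Module.End A M) (l : List (Fin 2)) (k : Fin 2) :
    wordOp P (l ++ [k]) = P k * wordOp P l := by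
  simp [wordOp]

theorem wordOp_cons (P : Fin 2 → Module.End A M) (k : Fin 2) (l : List (Fin 2)) :
    wordOp P (k :: l) = wordOp P l * P k := by
  induction l using List.reverseRecOn with
  | nil => simp [wordOp]
  | append_singleton l j ih => rw [← List.cons_append, wordOp_append, wordOp_append, ih, mul_assoc]

theorem wordOp_braid {P : Fin 2 → Module.End A M} (hP : (P 1 * P 0) ^ 3 = (P 0 * P 1) ^ 3) :
    wordOp P [0, 1, 0, 1, 0, 1] = wordOp P [1, 0, 1, 0, 1, 0] := by
  simpa [wordOp, pow_succ, mul_assoc] using hP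

theorem wordOp_mul_s {P : Fin 2 → Module.End A M} (hP : (P 1 * P 0) ^ 3 = (P 0 * P 1) ^ 3)
    (w : W) (k : Fin 2) (h : (word w).length < (word (w * s k)).length) :
    wordOp P (word (w * s k)) = P k * wordOp P (word w) := by
  rw [← wordOp_append]
  rcases word_mul_s w k h with h | ⟨h, h'⟩
  · rw [h]
  · rw [h, h', wordOp_braid hP]

theorem wordOp_s_mul {P : Fin 2 → Module.End A M} (hP : (P 1 * P 0) ^ 3 = (P 0 * P 1) ^ 3)
    (w : W) (k : Fin 2) (h : (word w).length < (word (s k * w)).length) :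
    wordOp P (word (s k * w)) = wordOp P (word w) * P k := by
  rw [← wordOp_cons]
  rcases word_s_mul w k h with h | ⟨h, h'⟩
  · rw [h]
  · rw [h, h', wordOp_braid hP]

theorem q_smul_q_smul (a b : ℤ) (x : M) : q a • q b • x = q (a + b) • x := by
  rw [smul_smul, q_mul]

/-- The vector q^ℓ(w) P_w x depends only on the coset W_b w, since a letter of `b` acts on `x` as
q⁻¹ and so cancels the gain in length. -/
theorem wordOp_par {P : Fin 2 → Module.End A M} (hP : (P 1 * P 0) ^ 3 = (P 0 * P 1) ^ 3)
    {b : Fin 2 → Bool} {x : M} (hx : ∀ k, b k → P k x = q (-1) • x) (u w : W) (hu : Par b u) :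
    q (word (u * w)).length • wordOp P (word (u * w)) x =
      q (word w).length • wordOp P (word w) x := by
  have key : ∀ k, b k → ∀ w, q (word (s k * w)).length • wordOp P (word (s k * w)) x =
      q (word w).length • wordOp P (word w) x := by
    have aux : ∀ k, b k → ∀ w, (word (s k * w)).length = (word w).length + 1 →
        q (word (s k * w)).length • wordOp P (word (s k * w)) x =
          q (word w).length • wordOp P (word w) x := by
      intro k hk w h
      rw [wordOp_s_mul hP w k (by omega), Module.End.mul_apply, hx k hk, map_smul, q_smul_q_smul, h]
      congr 2
      push_cast
      ring
    intro k hk w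
    rcases length_word_s_mul' k w with h | h
    · exact aux k hk w h
    · have := aux k hk (s k * w) (by rw [← mul_assoc, s_mul_s, one_mul, h])
      rw [← mul_assoc, s_mul_s, one_mul] at this
      exact this.symm
  rcases hu with rfl | ⟨k, hk, rfl⟩ | h
  · rw [one_mul]
  · exact key k hk w
  · rw [← prod_word u]
    induction word u with
    | nil => rw [List.map_nil, List.prod_nil, one_mul]
    | cons k l ih => rw [List.map_cons, List.prod_cons, mul_assoc, key k (h k), ih]

theorem exists_anti {n : ℕ} (i : X n) : ∃ (γ : Lam n) (w : W), i = (anti γ).ract w := by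
  obtain ⟨γ, w, h⟩ := i.2
  exact ⟨γ, w⁻¹, Subtype.ext (by rw [h, X.ract, inv_inv]; rfl)⟩

/-- The universal property of `𝕋_n`: an `ℋ`-linear map out of `𝕋_n` is determined by the images
of the anti-dominant basis elements, which may be arbitrary subject to invariance under the
stabilizers. -/
theorem exists_intertwiner {n : ℕ} {P : Fin 2 → Module.End A M}
    (hP : (P 1 * P 0) ^ 3 = (P 0 * P 1) ^ 3)
    (hsq : ∀ k x, P k (P k x) = x + (q (-1) - q 1) • P k x)
    (x : Lam n → M) (hx : ∀ γ k, fixes γ k → P k (x γ) = q (-1) • x γ) :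
    ∃ F : Tn n →ₗ[A] M, (∀ γ, F (v (anti γ)) = x γ) ∧ ∀ k y, F (heckeOp n k y) = P k (F y) := by
  choose c u hcu using exists_anti (n := n)
  -- `depth i` is the length of the shortest element leading from `anti (c i)` to `i`. The power of
  -- q makes the value independent of the choice of `u i` and equal to P_w x for the shortest w.
  let G : X n → M := fun i =>
    q ((word (u i)).length - depth i) • wordOp P (word (u i)) (x (c i))
  have hG : ∀ γ w, G ((anti γ).ract w) =
      q ((word w).length - depth ((anti γ).ract w)) • wordOp P (word w) (x γ) := by
    intro γ w
    set i := (anti γ).ract w with hi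
    have h1 : (anti (c i)).ract (u i * w⁻¹) = anti γ := by
      rw [← ract_ract, ← hcu i, hi, ract_ract, mul_inv_cancel, ract_one]
    have h2 : c i = γ := anti_eq_of_heights
      (heights_ract_dominant _ _ (anti_height _) (anti_height _) _ h1)
    rw [h2] at h1
    have h3 := wordOp_par hP (hx γ) _ w (par_of_ract_eq γ _ h1)
    rw [inv_mul_cancel_right] at h3
    change q ((word (u i)).length - depth i) • wordOp P (word (u i)) (x (c i)) = _
    rw [h2, sub_eq_neg_add, ← q_smul_q_smul, h3, q_smul_q_smul, sub_eq_neg_add]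
  clear_value G
  have hpos : ∀ k i, 0 < height k i → G (i.ract (s k)) = P k (G i) := by
    intro k i hk
    obtain ⟨γ, w, rfl⟩ := exists_anti i
    have hl : (word (w * s k)).length = (word w).length + 1 := by
      rcases length_word_mul_s w k with h | h
      · exact h
      · have := height_ract_nonpos _ (anti_height γ) w k (by omega)
        omega
    have hd := depth_ract_s k _ hk
    rw [ract_ract] at hd ⊢
    rw [hG, hG, hd, hl, wordOp_mul_s hP _ _ (by omega), map_smul, Module.End.mul_apply]
    congr 2
    push_cast
    ring
  have hzero : ∀ k i, height k i = 0 → P k (G i) = q (-1) • G i := by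
    intro k i hk
    -- At height zero both `w` and `w * s k` lead to `i`; the shorter one is taken.
    obtain ⟨γ, w, rfl, hl⟩ : ∃ γ w, i = (anti γ).ract w ∧
        (word (w * s k)).length = (word w).length + 1 := by
      obtain ⟨γ, w, rfl⟩ := exists_anti i
      rcases length_word_mul_s w k with h | h
      · exact ⟨γ, w, rfl, h⟩
      · refine ⟨γ, w * s k, ?_, ?_⟩
        · rw [← ract_ract, ract_eq_self k _ hk]
        · rw [mul_assoc, s_mul_s, mul_one, h]
    have h1 : (anti γ).ract (w * s k) = (anti γ).ract w := by
      rw [← ract_ract, ract_eq_self k _ hk]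
    have h2 := hG γ (w * s k)
    rw [h1, hl, wordOp_mul_s hP _ _ (by omega), Module.End.mul_apply] at h2
    have h3 := hG γ w
    have h4 := congrArg (P k) h3
    rw [map_smul] at h4
    rw [h4, h2, q_smul_q_smul]
    congr 2
    push_cast
    ring
  refine ⟨Finsupp.linearCombination A G, fun γ => ?_, fun k y => ?_⟩
  · have := hG γ 1
    rw [ract_one, depth_dominant _ (anti_height γ)] at this
    simpa [v, word_values.1, wordOp, q_zero] using this
  · have : (Finsupp.linearCombination A G) ∘ₗ heckeOp n k =
        P k ∘ₗ Finsupp.linearCombination A G := by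
      apply Finsupp.lhom_ext'
      intro i
      apply LinearMap.ext_ring
      change Finsupp.linearCombination A G (heckeOp n k (v i)) =
        P k (Finsupp.linearCombination A G (v i))
      have hv : ∀ i, Finsupp.linearCombination A G (v i) = G i := fun i => by simp [v]
      rcases lt_trichotomy (height k i) 0 with h | h | h
      · have := hpos k (i.ract (s k)) (by rw [height_s]; omega)
        rw [ract_s_s] at this
        rw [heckeOp_neg k i h, map_add, map_smul, hv, hv, this, hsq]
      · rw [heckeOp_zero k i h, map_smul, hv, hzero k i h]
      · rw [heckeOp_pos k i h, hv, hv, hpos k i h]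
    exact LinearMap.congr_fun this y

end Universal

/-! ### Elements of the `q`-Schur algebra -/

theorem Sq_heckeOp {n : ℕ} (η : Sq n) (k : Fin 2) (x : Tn n) :
    η.1 (heckeOp n k x) = heckeOp n k (η.1 x) := by
  have := (Subalgebra.mem_centralizer_iff A).mp η.2 (heckeOp n k)
    ⟨Hecke.gen k, by simp only [rightAction_gen, MulOpposite.unop_op]⟩
  exact (LinearMap.congr_fun this x).symm

theorem mem_Sq {n : ℕ} (F : Module.End A (Tn n))
    (hF : ∀ k x, F (heckeOp n k x) = heckeOp n k (F x)) : F ∈ Sq n := by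
  refine (Subalgebra.mem_centralizer_iff A).mpr ?_
  rintro _ ⟨h, rfl⟩
  change MulOpposite.unop (rightAction n h) * F = F * MulOpposite.unop (rightAction n h)
  obtain ⟨h, rfl⟩ := RingQuot.mkAlgHom_surjective A HeckeRel h
  induction h using FreeAlgebra.induction with
  | grade0 r => simp only [AlgHom.commutes, MulOpposite.algebraMap_apply, MulOpposite.unop_op,
      Algebra.commutes]
  | grade1 k =>
    change MulOpposite.unop (rightAction n (Hecke.gen k)) * F = _ * MulOpposite.unop
      (rightAction n (Hecke.gen k))
    rw [rightAction_gen, MulOpposite.unop_op]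
    exact LinearMap.ext fun x => (hF k x).symm
  | mul a b ha hb =>
    rw [map_mul, map_mul, MulOpposite.unop_mul, mul_assoc, ha, ← mul_assoc, hb, mul_assoc]
  | add a b ha hb => rw [map_add, map_add, MulOpposite.unop_add, add_mul, ha, hb, mul_add]

theorem submodule_eq_top {n : ℕ} (N : Submodule A (Tn n)) (h0 : ∀ γ, v (anti γ) ∈ N)
    (hN : ∀ k, ∀ x ∈ N, heckeOp n k x ∈ N) : N = ⊤ := by
  have hv : ∀ i, v i ∈ N := by
    intro i
    induction i using X_induction with
    | h0 γ => exact h0 γ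
    | hs k i h =>
      rcases lt_trichotomy (height k i) 0 with h' | h' | h'
      · have e : v (i.ract (s k)) = heckeOp n k (v i) - (q (-1) - q 1) • v i := by
          rw [heckeOp_neg k i h']; abel
        rw [e]
        exact N.sub_mem (hN k _ h) (N.smul_mem _ h)
      · rwa [ract_eq_self k i h']
      · rw [← heckeOp_pos k i h']
        exact hN k _ h
  rw [eq_top_iff]
  intro x _
  induction x using Finsupp.induction_linear with
  | zero => exact N.zero_mem
  | add x y hx hy => exact N.add_mem (hx trivial) (hy trivial)
  | single i b =>
    have : (Finsupp.single i b : Tn n) = b • v i := by simp [v]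
    rw [this]
    exact N.smul_mem _ (hv i)

theorem Sq_ext {n : ℕ} {η θ : Sq n} (h : ∀ γ, η.1 (v (anti γ)) = θ.1 (v (anti γ))) : η = θ := by
  have := submodule_eq_top (LinearMap.eqLocus η.1 θ.1) h (fun k x hx => by
    change η.1 _ = θ.1 _
    rw [Sq_heckeOp, Sq_heckeOp, show η.1 x = θ.1 x from hx])
  exact Subtype.ext (LinearMap.ext fun x =>
    show x ∈ LinearMap.eqLocus η.1 θ.1 by rw [this]; trivial)

theorem exists_Sq {n : ℕ} (ν : Lam n) (x : Tn n)
    (hx : ∀ k, fixes ν k → heckeOp n k x = q (-1) • x) :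
    ∃ η : Sq n, η.1 (v (anti ν)) = x ∧ ∀ ν', ν' ≠ ν → η.1 (v (anti ν')) = 0 := by
  classical
  obtain ⟨F, hF, hF'⟩ := exists_intertwiner (P := heckeOp n) (heckeOp_braid n)
    (fun k x => heckeOp_sq n k x) (fun γ => if γ = ν then x else 0) (by
      intro γ k hk
      by_cases h : γ = ν
      · subst h; simpa using hx k hk
      · simp [h])
  exact ⟨⟨F, mem_Sq F hF'⟩, by rw [hF, if_pos rfl], fun ν' h => by rw [hF, if_neg h]⟩

/-- The value of `[φ_{γν}^g]` at `v_{i⁻_ν}`. -/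
noncomputable def stdVal {n : ℕ} (γ : Lam n) (g : W) (ν : Lam n) : Tn n :=
  ∑ w ∈ minReps (fixes γ) g (fixes ν),
    q ((maxWord (Dcos (fixes γ) g (fixes ν)) : ℤ) - maxWord (Par (fixes γ)) - (word w).length) •
      v ((anti γ).ract w)

/-- Since `phi` is a choice, its defining property has to be shown satisfiable: `exists_Sq` gives a
witness once the intended value is an eigenvector for the walls of ν. -/
theorem std_spec {n : ℕ} (γ : Lam n) (g : W) (ν : Lam n)
    (hx : ∀ k, fixes ν k → heckeOp n k (stdVal γ g ν) = q (-1) • stdVal γ g ν) :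
    (std γ g ν).1 (v (anti ν)) = stdVal γ g ν ∧
      ∀ ν', ν' ≠ ν → (std γ g ν).1 (v (anti ν')) = 0 := by
  classical
  obtain ⟨η, h1, h2⟩ := exists_Sq ν
    (q (maxLen (parab ν) - maxLen (dcoset γ g ν) : ℤ) • stdVal γ g ν)
    (fun k hk => by rw [map_smul, hx k hk, smul_comm])
  have hval : q ((maxLen (parab ν) : ℤ) - maxLen (parab γ)) •
      ∑ w ∈ Finset.univ.filter (· ∈ rightReps γ g ν), q (-(len w : ℤ)) • v ((anti γ).ract w) =
      q (maxLen (parab ν) - maxLen (dcoset γ g ν) : ℤ) • stdVal γ g ν := by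
    rw [stdVal, Finset.smul_sum, Finset.smul_sum]
    refine Finset.sum_congr (by ext w; simp [mem_rightReps]) fun w _ => ?_
    rw [q_smul_q_smul, q_smul_q_smul, len_eq,
      ← maxLen_eq _ _ (fun w => mem_dcoset γ g ν w), ← maxLen_eq _ _ (fun w => mem_parab γ w)]
    congr 2
    ring
  have hspec := Classical.epsilon_spec (p := fun f : Sq n => ∀ ν' : Lam n,
    (f : Module.End A (Tn n)) (v (anti ν')) =
    if ν' = ν then
      q ((maxLen (parab ν) : ℤ) - maxLen (parab γ)) •
        ∑ w ∈ Finset.univ.filter (· ∈ rightReps γ g ν), q (-(len w : ℤ)) • v ((anti γ).ract w)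
    else 0) ⟨η, fun ν' => by
      split_ifs with h
      · rw [h, hval]; exact h1
      · exact h2 ν' h⟩
  have hphi : ∀ ν' : Lam n, (phi γ g ν).1 (v (anti ν')) =
      if ν' = ν then q (maxLen (parab ν) - maxLen (dcoset γ g ν) : ℤ) • stdVal γ g ν else 0 := by
    rw [← hval]
    unfold phi
    convert hspec
  have hstd : ∀ x, (std γ g ν).1 x =
      q ((maxLen (dcoset γ g ν) : ℤ) - maxLen (parab ν)) • (phi γ g ν).1 x := fun x => rfl
  refine ⟨?_, fun ν' h => ?_⟩
  · rw [hstd, hphi, if_pos rfl, q_smul_q_smul]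
    simp [q_zero]
  · rw [hstd, hphi, if_neg h, smul_zero]

/-! ### The bar involution -/

/-- The module `𝕋_n` with scalars twisted by `q ↦ q⁻¹`. -/
def Twist (n : ℕ) : Type := Tn n

noncomputable instance (n : ℕ) : AddCommGroup (Twist n) := inferInstanceAs (AddCommGroup (Tn n))

noncomputable instance (n : ℕ) : Module A (Twist n) :=
  Module.compHom (Tn n) (LaurentPolynomial.invert (R := ℤ) : A →+* A)

theorem invert_q (m : ℤ) : LaurentPolynomial.invert (q m) = q (-m) := LaurentPolynomial.invert_T m

/-- The Hecke generators as invertible operators. -/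
noncomputable def heckeUnit (n : ℕ) (k : Fin 2) : (Module.End A (Tn n))ˣ where
  val := heckeOp n k
  inv := heckeOp n k - (q (-1) - q 1) • 1
  val_inv := by
    apply LinearMap.ext
    intro x
    simp [heckeOp_sq]
  inv_val := by
    apply LinearMap.ext
    intro x
    simp [heckeOp_sq]

/-- The identity map from `𝕋_n` to its twist. -/
noncomputable def toTwist (n : ℕ) : Tn n ≃+ Twist n := AddEquiv.refl _

theorem smul_toTwist {n : ℕ} (p : A) (x : Tn n) :
    p • toTwist n x = toTwist n (LaurentPolynomial.invert p • x) := rfl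

/-- The inverse Hecke generators on the twisted module. -/
noncomputable def twistOp (n : ℕ) (k : Fin 2) : Module.End A (Twist n) where
  toFun x := toTwist n ((↑(heckeUnit n k)⁻¹ : Module.End A (Tn n)) ((toTwist n).symm x))
  map_add' x y := by rw [map_add, map_add, map_add]
  map_smul' p x := by
    obtain ⟨x, rfl⟩ := (toTwist n).surjective x
    rw [smul_toTwist, AddEquiv.symm_apply_apply, AddEquiv.symm_apply_apply, LinearMap.map_smul,
      RingHom.id_apply, smul_toTwist]

theorem twistOp_apply {n : ℕ} (k : Fin 2) (x : Tn n) : twistOp n k (toTwist n x) =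
    toTwist n ((↑(heckeUnit n k)⁻¹ : Module.End A (Tn n)) x) := rfl

theorem heckeUnit_inv_apply {n : ℕ} (k : Fin 2) (x : Tn n) :
    (↑(heckeUnit n k)⁻¹ : Module.End A (Tn n)) x = heckeOp n k x - (q (-1) - q 1) • x := rfl

theorem heckeUnit_apply_inv {n : ℕ} (k : Fin 2) (x : Tn n) :
    heckeOp n k ((↑(heckeUnit n k)⁻¹ : Module.End A (Tn n)) x) = x :=
  LinearMap.congr_fun (heckeUnit n k).mul_inv x

theorem twistOp_braid (n : ℕ) :
    (twistOp n 1 * twistOp n 0) ^ 3 = (twistOp n 0 * twistOp n 1) ^ 3 := by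
  have hu : (heckeUnit n 1 * heckeUnit n 0) ^ 3 = (heckeUnit n 0 * heckeUnit n 1) ^ 3 :=
    Units.ext (heckeOp_braid n)
  have h := congrArg (fun u : (Module.End A (Tn n))ˣ => (↑u⁻¹ : Module.End A (Tn n))) hu
  simp only [← inv_pow, mul_inv_rev] at h
  apply LinearMap.ext
  intro x
  obtain ⟨x, rfl⟩ := (toTwist n).surjective x
  simp only [pow_succ, pow_zero, one_mul, Units.val_mul] at h
  simp only [pow_succ, pow_zero, one_mul, Module.End.mul_apply, twistOp_apply]
  exact congrArg (toTwist n) (LinearMap.congr_fun h x).symm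

theorem twistOp_sq {n : ℕ} (k : Fin 2) (x : Twist n) :
    twistOp n k (twistOp n k x) = x + (q (-1) - q 1) • twistOp n k x := by
  obtain ⟨x, rfl⟩ := (toTwist n).surjective x
  rw [twistOp_apply, twistOp_apply, smul_toTwist, ← map_add]
  congr 1
  rw [heckeUnit_inv_apply, heckeUnit_apply_inv, map_sub, invert_q, invert_q, neg_neg,
    ← neg_sub (q (-1)) (q 1), neg_smul, sub_eq_add_neg]

/-- With scalars twisted by q ↦ q⁻¹, the inverse generators satisfy the same quadratic and braid
relations, so the universal property gives a map from `𝕋_n` to its twist. -/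
theorem exists_isBar (n : ℕ) : ∃ β : Tn n →+ Tn n, IsBar β := by
  obtain ⟨F, hF, hF'⟩ := exists_intertwiner (P := twistOp n) (twistOp_braid n) twistOp_sq
    (fun γ => toTwist n (v (anti γ))) (by
    intro γ k hk
    rw [twistOp_apply, smul_toTwist, heckeUnit_inv_apply,
      heckeOp_zero k _ (by simpa [fixes] using hk), invert_q, neg_neg,
      ← sub_smul, sub_sub_cancel])
  refine ⟨(toTwist n).symm.toAddMonoidHom.comp F.toAddMonoidHom, fun p x => ?_, fun γ => ?_,
    fun k x => ?_⟩
  · change (toTwist n).symm (F (p • x)) = _ • (toTwist n).symm (F x)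
    obtain ⟨y, hy⟩ := (toTwist n).surjective (F x)
    rw [map_smul, ← hy, smul_toTwist, AddEquiv.symm_apply_apply, AddEquiv.symm_apply_apply]
  · change (toTwist n).symm (F _) = _
    rw [hF, AddEquiv.symm_apply_apply]
  · change heckeOp n k ((toTwist n).symm (F _)) = (toTwist n).symm (F x)
    obtain ⟨y, hy⟩ := (toTwist n).surjective (F x)
    rw [hF', ← hy, twistOp_apply, AddEquiv.symm_apply_apply, AddEquiv.symm_apply_apply,
      heckeUnit_apply_inv]

theorem isBar_bar (n : ℕ) : IsBar (bar n) := Classical.epsilon_spec (exists_isBar n)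

theorem bar_smul {n : ℕ} (p : A) (x : Tn n) :
    bar n (p • x) = LaurentPolynomial.invert p • bar n x := (isBar_bar n).1 p x

theorem bar_anti {n : ℕ} (γ : Lam n) : bar n (v (anti γ)) = v (anti γ) := (isBar_bar n).2.1 γ

theorem bar_heckeOp {n : ℕ} (k : Fin 2) (x : Tn n) :
    bar n (heckeOp n k x) = heckeOp n k (bar n x) - (q (-1) - q 1) • bar n x := by
  have h := (isBar_bar n).2.2 k x
  rw [← h, heckeOp_sq]
  simp

/-- The action of the Kazhdan-Lusztig generator `H_k + q`. -/
noncomputable def C (n : ℕ) (k : Fin 2) : Module.End A (Tn n) := heckeOp n k + q 1 • 1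

theorem C_apply {n : ℕ} (k : Fin 2) (x : Tn n) : C n k x = heckeOp n k x + q 1 • x := rfl

theorem heckeOp_eq {n : ℕ} (k : Fin 2) (x : Tn n) : heckeOp n k x = C n k x - q 1 • x := by
  rw [C_apply]; abel

theorem heckeOp_C {n : ℕ} (k : Fin 2) (x : Tn n) : heckeOp n k (C n k x) = q (-1) • C n k x := by
  rw [C_apply, map_add, map_smul, heckeOp_sq, smul_add, q_smul_q_smul, neg_add_cancel, q_zero,
    one_smul]
  module

theorem C_of_heckeOp {n : ℕ} {k : Fin 2} {x : Tn n} (h : heckeOp n k x = q (-1) • x) :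
    C n k x = (q (-1) + q 1) • x := by
  rw [C_apply, h, add_smul]

theorem C_C {n : ℕ} (k : Fin 2) (x : Tn n) : C n k (C n k x) = (q (-1) + q 1) • C n k x :=
  C_of_heckeOp (heckeOp_C k x)

theorem Sq_C {n : ℕ} (η : Sq n) (k : Fin 2) (x : Tn n) : η.1 (C n k x) = C n k (η.1 x) := by
  rw [C_apply, map_add, map_smul, Sq_heckeOp, C_apply]

theorem bar_C {n : ℕ} (k : Fin 2) (x : Tn n) : bar n (C n k x) = C n k (bar n x) := by
  rw [C_apply, map_add, bar_heckeOp, bar_smul, invert_q, C_apply]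
  module

theorem C_anti {n : ℕ} {γ : Lam n} {k : Fin 2} (h : fixes γ k) :
    C n k (v (anti γ)) = (q (-1) + q 1) • v (anti γ) :=
  C_of_heckeOp (heckeOp_zero k _ (by simpa [fixes] using h))

theorem heckeOp_anti {n : ℕ} {γ : Lam n} {k : Fin 2} (h : fixes γ k) :
    heckeOp n k (v (anti γ)) = q (-1) • v (anti γ) :=
  heckeOp_zero k _ (by simpa [fixes] using h)

theorem height_anti_pos {n : ℕ} {γ : Lam n} {k : Fin 2} (h : fixes γ k = false) :
    0 < height k (anti γ) :=
  lt_of_le_of_ne (anti_height γ k) (by simpa [fixes, eq_comm] using h)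

/-! ### Values of canonical basis elements -/

/-- The `ℋ`-linear map `η` sends `v_{i⁻_ν}` to `y` and kills the other anti-dominant generators. -/
def Maps {n : ℕ} (η : Sq n) (ν : Lam n) (y : Tn n) : Prop :=
  η.1 (v (anti ν)) = y ∧ ∀ ν', ν' ≠ ν → η.1 (v (anti ν')) = 0

theorem Maps.unique {n : ℕ} {η θ : Sq n} {ν : Lam n} {y : Tn n} (h : Maps η ν y)
    (h' : Maps θ ν y) : η = θ := Sq_ext fun γ => by
  by_cases hγ : γ = ν
  · rw [hγ, h.1, h'.1]
  · rw [h.2 γ hγ, h'.2 γ hγ]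

theorem Maps.add {n : ℕ} {η θ : Sq n} {ν : Lam n} {y z : Tn n} (h : Maps η ν y)
    (h' : Maps θ ν z) : Maps (η + θ) ν (y + z) :=
  ⟨by change η.1 _ + θ.1 _ = _; rw [h.1, h'.1],
    fun ν' hν => by change η.1 _ + θ.1 _ = _; rw [h.2 ν' hν, h'.2 ν' hν, add_zero]⟩

theorem Maps.smul {n : ℕ} {η : Sq n} {ν : Lam n} {y : Tn n} (c : A) (h : Maps η ν y) :
    Maps (c • η) ν (c • y) :=
  ⟨by change c • η.1 _ = _; rw [h.1],
    fun ν' hν => by change c • η.1 _ = _; rw [h.2 ν' hν, smul_zero]⟩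

theorem Maps.barInvariant_iff {n : ℕ} {η : Sq n} {ν : Lam n} {y : Tn n} (h : Maps η ν y) :
    BarInvariant η ↔ bar n y = y := by
  constructor
  · intro hb
    have := hb ν
    rwa [h.1] at this
  · intro hy ν'
    by_cases hν : ν' = ν
    · rw [hν, h.1, hy]
    · rw [h.2 ν' hν, map_zero]

theorem maps_std {n : ℕ} {γ : Lam n} {g : W} {ν : Lam n} {x : Tn n} (hx : stdVal γ g ν = x)
    (hfix : ∀ k, fixes ν k → heckeOp n k x = q (-1) • x) : Maps (std γ g ν) ν x := by
  subst hx
  exact std_spec γ g ν hfix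

theorem len_one : len 1 = 0 := by rw [len_eq]; rfl

theorem len_s (k : Fin 2) : len (s k) = 1 := by rw [len_eq, word_values.2.1]; rfl

/-- No element is shorter than 1, so the correction sum is empty and the canonical element is the
standard one. -/
theorem maps_can_one {n : ℕ} {γ ν : Lam n} {x : Tn n} (hx : stdVal γ 1 ν = x)
    (hfix : ∀ k, fixes ν k → heckeOp n k x = q (-1) • x) (hbar : bar n x = x) :
    Maps (can γ 1 ν) ν x := by
  classical
  have hm := maps_std hx hfix
  obtain ⟨-, p, hp⟩ := Classical.epsilon_spec (p := fun f : Sq n => BarInvariant f ∧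
    ∃ p : W → Polynomial ℤ, f = std γ 1 ν +
      ∑ y ∈ Finset.univ.filter (fun y => y ∈ minRep γ ν ∧ len y < len 1),
        Polynomial.toLaurent (Polynomial.X * p y) • std γ y ν)
    ⟨std γ 1 ν, hm.barInvariant_iff.mpr hbar, 0, by simp⟩
  have hcan : can γ 1 ν = std γ 1 ν := by
    unfold can
    convert hp using 1
    simp [len_one]
  rwa [hcan]

theorem trunc_invert (P : Polynomial ℤ) : LaurentPolynomial.trunc
    (LaurentPolynomial.invert (Polynomial.toLaurent (Polynomial.X * P))) = 0 := by
  induction P using Polynomial.induction_on' with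
  | add P Q hP hQ => rw [mul_add, map_add, map_add, map_add, hP, hQ, add_zero]
  | monomial m r =>
    rw [Polynomial.X_mul_monomial, Polynomial.toLaurent_C_mul_T, map_mul,
      LaurentPolynomial.invert_C, LaurentPolynomial.invert_T, LaurentPolynomial.trunc_C_mul_T,
      if_neg (by push_cast; omega)]

/-- Inversion sends qℤ[q] into q⁻¹ℤ[q⁻¹], and the two meet only in 0. -/
theorem eq_zero_of_invert {P : Polynomial ℤ}
    (h : LaurentPolynomial.invert (Polynomial.toLaurent (Polynomial.X * P)) =
      Polynomial.toLaurent (Polynomial.X * P)) :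
    (Polynomial.toLaurent (Polynomial.X * P) : A) = 0 := by
  have h1 := trunc_invert P
  rw [h, Polynomial.trunc_toLaurent] at h1
  rw [h1, map_zero]

theorem smul_v_injective {n : ℕ} {a b : A} (i : X n) (h : a • v i = b • v i) : a = b := by
  simpa [v] using DFunLike.congr_fun h i

theorem stdVal_one_sub {n : ℕ} {γ ν : Lam n} (h : ∀ k, fixes ν k → fixes γ k) :
    stdVal γ 1 ν = v (anti γ) := by
  rw [stdVal, minReps_one _ _ h, maxWord_one _ _ h, Finset.sum_singleton, word_values.1, ract_one]
  simp [q_zero]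

theorem maps_std_one_self {n : ℕ} (γ : Lam n) : Maps (std γ 1 γ) γ (v (anti γ)) :=
  maps_std (stdVal_one_sub fun _ => id) fun _ h => heckeOp_anti h

/-- Only 1 is shorter than `s 0`, so two candidates differ by a multiple of `v (anti γ)` whose
coefficient is bar invariant and lies in qℤ[q], hence vanishes. -/
theorem maps_can_s {n : ℕ} {γ : Lam n} {x : Tn n} (m : ℕ)
    (hx : stdVal γ (s 0) γ + q (m + 1) • v (anti γ) = x)
    (hfix : ∀ k, fixes γ k → heckeOp n k x = q (-1) • x) (hbar : bar n x = x) :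
    Maps (can γ (s 0) γ) γ x := by
  classical
  have h1 := maps_std_one_self γ
  have hs : Maps (std γ (s 0) γ) γ (stdVal γ (s 0) γ) := maps_std rfl fun k hk => by
    rw [eq_sub_of_add_eq hx, map_sub, map_smul, hfix k hk, heckeOp_anti hk, smul_sub, smul_comm]
  have hmin : Finset.univ.filter (fun y => y ∈ minRep γ γ ∧ len y < len (s 0)) = {1} := by
    ext w
    simp only [Finset.mem_filter, Finset.mem_univ, true_and, Finset.mem_singleton, len_s]
    constructor
    · rintro ⟨-, h⟩
      have h0 : (word w).length = 0 := by rw [← len_eq]; omega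
      rw [← prod_word w, List.length_eq_zero_iff.mp h0]
      rfl
    · rintro rfl
      exact ⟨fun w _ => by simp [len_one], by simp [len_one]⟩
  have hq : (Polynomial.toLaurent (Polynomial.X * Polynomial.X ^ m : Polynomial ℤ) : A) =
      q (m + 1) := by
    rw [← pow_succ', Polynomial.toLaurent_X_pow]; push_cast; rfl
  have hθ : Maps (std γ (s 0) γ + q (m + 1) • std γ 1 γ) γ x := hx ▸ hs.add (h1.smul _)
  obtain ⟨hb, p, hp⟩ := Classical.epsilon_spec (p := fun f : Sq n => BarInvariant f ∧
    ∃ p : W → Polynomial ℤ, f = std γ (s 0) γ +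
      ∑ y ∈ Finset.univ.filter (fun y => y ∈ minRep γ γ ∧ len y < len (s 0)),
        Polynomial.toLaurent (Polynomial.X * p y) • std γ y γ)
    ⟨_, hθ.barInvariant_iff.mpr hbar, fun _ => Polynomial.X ^ m, by
      rw [hmin, Finset.sum_singleton, hq]⟩
  have hcan : can γ (s 0) γ = std γ (s 0) γ +
      (Polynomial.toLaurent (Polynomial.X * p 1) : A) • std γ 1 γ := by
    unfold can
    convert hp using 1
    rw [hmin, Finset.sum_singleton]
  have hbar' : BarInvariant (can γ (s 0) γ) := by
    unfold can
    convert hb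
  have hm : Maps (can γ (s 0) γ) γ
      (x + (Polynomial.toLaurent (Polynomial.X * (p 1 - Polynomial.X ^ m)) : A) • v (anti γ)) := by
    have := hs.add (h1.smul (Polynomial.toLaurent (Polynomial.X * p 1) : A))
    rw [← hcan] at this
    convert this using 1
    rw [← hx, mul_sub, map_sub, hq]
    module
  have h2 := hm.barInvariant_iff.mp hbar'
  rw [map_add, hbar, bar_smul, bar_anti] at h2
  have h3 := eq_zero_of_invert (smul_v_injective _ (add_left_cancel h2))
  rwa [h3, zero_smul, add_zero] at hm

theorem one_ne_s : ∀ k, (1 : W) ≠ s k := by decide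

theorem stdVal_one_pair {n : ℕ} {γ ν : Lam n} {k : Fin 2} (hγ : fixes γ k = false)
    (hν : ∀ j, fixes ν j ↔ j = k) : stdVal γ 1 ν = C n k (v (anti γ)) := by
  rw [stdVal, minReps_pair _ _ k hγ hν, maxWord_pair _ _ k hγ hν, Finset.sum_pair (one_ne_s k),
    word_values.1, word_values.2.1, ract_one, C_apply, heckeOp_pos _ _ (height_anti_pos hγ)]
  simp [q_zero, add_comm]

theorem stdVal_s_wall {n : ℕ} {γ : Lam n} (hγ : ∀ j, fixes γ j ↔ j = 1) :
    stdVal γ (s 0) γ = C n 1 (heckeOp n 0 (v (anti γ))) := by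
  have h0 : 0 < height 0 (anti γ) := height_anti_pos (by simpa using (hγ 0).not)
  have h1 : height 1 (anti γ) = 0 := by simpa [fixes] using (hγ 1).mpr rfl
  rw [stdVal, minReps_s_wall _ hγ, maxWord_s_wall _ hγ, Finset.sum_pair (by decide),
    word_values.2.1, word_values.2.2.1, C_apply, heckeOp_pos _ _ h0,
    heckeOp_pos _ _ (by rw [height_10]; omega), ract_ract]
  simp [q_zero, add_comm]

/-- The Kazhdan-Lusztig element of the longest coset representative, as an operator on the
invariants of the second generator. -/
noncomputable def K (n : ℕ) : Module.End A (Tn n) :=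
  C n 0 * C n 1 * C n 0 * C n 1 * C n 0 - (4 : A) • (C n 0 * C n 1 * C n 0) + (3 : A) • C n 0

theorem K_apply {n : ℕ} (x : Tn n) : K n x = C n 0 (C n 1 (C n 0 (C n 1 (C n 0 x)))) -
    (4 : A) • C n 0 (C n 1 (C n 0 x)) + (3 : A) • C n 0 x := rfl

/-- The coefficients 1, −4, 3 in `K` are those of the Chebyshev polynomial U₅(x) = x⁵ − 4x³ + 3x,
which expresses the Kazhdan-Lusztig element of a word of five alternating letters through products
of the C_k. Expanded along the six points of the orbit, `K` gives the powers q⁵, …, q, 1. -/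
theorem stdVal_full {n : ℕ} {γ ν : Lam n} (hγ : ∀ j, fixes γ j ↔ j = 1) (hν : ∀ j, fixes ν j) :
    stdVal γ 1 ν = K n (v (anti γ)) ∧
      ∀ k, heckeOp n k (K n (v (anti γ))) = q (-1) • K n (v (anti γ)) := by
  have h0 : 0 < height 0 (anti γ) := height_anti_pos (by simpa using (hγ 0).not)
  have h1 : height 1 (anti γ) = 0 := by simpa [fixes] using (hγ 1).mpr rfl
  set i := anti γ with hi
  have e0 : heckeOp n 1 (v i) = q (-1) • v i := heckeOp_zero _ _ h1
  have e1 : heckeOp n 0 (v i) = v (i.ract (s 0)) := heckeOp_pos _ _ h0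
  have e2 : heckeOp n 1 (v (i.ract (s 0))) = v (i.ract (s 0 * s 1)) := by
    rw [heckeOp_pos, ract_ract]
    simp only [height_10]; omega
  have e3 : heckeOp n 0 (v (i.ract (s 0 * s 1))) = v (i.ract (s 0 * s 1 * s 0)) := by
    rw [heckeOp_pos, ract_ract]
    simp only [← ract_ract, height_00, height_01, height_10]; omega
  have e4 : heckeOp n 1 (v (i.ract (s 0 * s 1 * s 0))) = v (i.ract (s 0 * s 1 * s 0 * s 1)) := by
    rw [heckeOp_pos, ract_ract]
    simp only [← ract_ract, height_00, height_01, height_10, height_11]; omega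
  have e5 : heckeOp n 0 (v (i.ract (s 0 * s 1 * s 0 * s 1))) =
      v (i.ract (s 0 * s 1 * s 0 * s 1 * s 0)) := by
    rw [heckeOp_pos, ract_ract]
    simp only [← ract_ract, height_00, height_01, height_10, height_11]; omega
  -- The longest element acts as −1 and `s 1` fixes `i`, so this point has the weight −i and again
  -- lies on the wall of `s 1`.
  have e6 : heckeOp n 1 (v (i.ract (s 0 * s 1 * s 0 * s 1 * s 0))) =
      q (-1) • v (i.ract (s 0 * s 1 * s 0 * s 1 * s 0)) := by
    rw [heckeOp_zero]
    simp only [← ract_ract, height_00, height_01, height_10, height_11]; omega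
  have f1 := heckeOp_sq n 0 (v i)
  have f2 := heckeOp_sq n 1 (v (i.ract (s 0)))
  have f3 := heckeOp_sq n 0 (v (i.ract (s 0 * s 1)))
  have f4 := heckeOp_sq n 1 (v (i.ract (s 0 * s 1 * s 0)))
  rw [e1] at f1
  rw [e2] at f2
  rw [e3] at f3
  rw [e4] at f4
  have hqq : q (-1) * q 1 = 1 := by rw [q_mul, neg_add_cancel, q_zero]
  have hpow : ∀ m : ℕ, q m = q 1 ^ m := fun m => by
    simp [q, LaurentPolynomial.T_pow]
  have hstd : stdVal γ 1 ν = q 1 ^ 5 • v i + q 1 ^ 4 • v (i.ract (s 0)) +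
      q 1 ^ 3 • v (i.ract (s 0 * s 1)) + q 1 ^ 2 • v (i.ract (s 0 * s 1 * s 0)) +
      q 1 • v (i.ract (s 0 * s 1 * s 0 * s 1)) + v (i.ract (s 0 * s 1 * s 0 * s 1 * s 0)) := by
    have hE : ∀ j : ℤ, ((maxWord (Par (fixes γ)) + 5 : ℕ) : ℤ) - maxWord (Par (fixes γ)) - j =
        5 - j := fun j => by push_cast; ring
    rw [stdVal, minReps_full _ _ hγ hν, maxWord_full _ _ hγ hν, Finset.sum_insert (by decide),
      Finset.sum_insert (by decide), Finset.sum_insert (by decide), Finset.sum_insert (by decide),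
      Finset.sum_pair (by decide)]
    obtain ⟨w0, w1, w2, w3, w4, w5⟩ := word_values
    simp only [w0, w1, w2, w3, w4, w5, hE, ract_one, List.length_nil, List.length_cons, ← hpow]
    norm_num [q_zero, add_assoc, ← hi]
  have hK : K n (v i) = q 1 ^ 5 • v i + q 1 ^ 4 • v (i.ract (s 0)) +
      q 1 ^ 3 • v (i.ract (s 0 * s 1)) + q 1 ^ 2 • v (i.ract (s 0 * s 1 * s 0)) +
      q 1 • v (i.ract (s 0 * s 1 * s 0 * s 1)) + v (i.ract (s 0 * s 1 * s 0 * s 1 * s 0)) := by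
    simp only [K_apply, C_apply, map_add, map_smul, e0, e1, e2, e3, e4, e5, f1, f2, f3]
    match_scalars <;> grind
  refine ⟨hstd.trans hK.symm, ?_⟩
  rw [Fin.forall_fin_two]
  constructor
  -- `C n 0` is the outermost factor of `K`, and its values are eigenvectors of `heckeOp n 0`. For
  -- the other generator the expansion `hK` is used.
  · have : K n (v i) = C n 0 (C n 1 (C n 0 (C n 1 (C n 0 (v i)))) -
        (4 : A) • C n 1 (C n 0 (v i)) + (3 : A) • v i) := by
      rw [map_add, map_sub, map_smul, map_smul, K_apply]
    rw [this, heckeOp_C]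
  · rw [hK]
    simp only [map_add, map_smul, e0, e2, e4, e6, f2, f4]
    match_scalars <;> grind

/-! ### Blocks -/

theorem maps_can_sub {n : ℕ} {γ ν : Lam n} (h : ∀ k, fixes ν k → fixes γ k) :
    Maps (can γ 1 ν) ν (v (anti γ)) :=
  maps_can_one (stdVal_one_sub h) (fun k hk => heckeOp_anti (h k hk)) (bar_anti γ)

theorem maps_can_pair {n : ℕ} {γ ν : Lam n} {k : Fin 2} (hγ : fixes γ k = false)
    (hν : ∀ j, fixes ν j ↔ j = k) : Maps (can γ 1 ν) ν (C n k (v (anti γ))) :=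
  maps_can_one (stdVal_one_pair hγ hν) (fun j hj => by rw [(hν j).mp hj]; exact heckeOp_C k _)
    (by rw [bar_C, bar_anti])

theorem bar_K {n : ℕ} (x : Tn n) : bar n (K n x) = K n (bar n x) := by
  have h4 : LaurentPolynomial.invert (4 : A) = 4 := map_ofNat _ 4
  have h3 : LaurentPolynomial.invert (3 : A) = 3 := map_ofNat _ 3
  simp only [K_apply, map_add, map_sub, bar_smul, bar_C, h3, h4]

theorem Sq_K {n : ℕ} (η : Sq n) (x : Tn n) : η.1 (K n x) = K n (η.1 x) := by
  simp only [K_apply, map_add, map_sub, map_smul, Sq_C]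

theorem maps_can_full {n : ℕ} {γ ν : Lam n} (hγ : ∀ j, fixes γ j ↔ j = 1)
    (hν : ∀ j, fixes ν j) : Maps (can γ 1 ν) ν (K n (v (anti γ))) :=
  maps_can_one (stdVal_full hγ hν).1 (fun k _ => (stdVal_full hγ hν).2 k)
    (by rw [bar_K, bar_anti])

/-- C_1 C_0 v = C_1 H_0 v + q[2] v, and q[2] = 1 + q². Removing v leaves the standard value plus q²
v, whence the exponent parameter 1 in `maps_can_s`. -/
theorem maps_can_s_wall {n : ℕ} {γ : Lam n} (hγ : ∀ j, fixes γ j ↔ j = 1) :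
    Maps (can γ (s 0) γ) γ (C n 1 (C n 0 (v (anti γ))) - v (anti γ)) := by
  have h1 := (hγ 1).mpr rfl
  refine maps_can_s 1 ?_ (fun k hk => ?_) ?_
  · rw [stdVal_s_wall hγ, C_apply 0, map_add, map_smul, C_anti h1, smul_smul, mul_add, q_mul,
      q_mul, add_smul]
    norm_num [q_zero]
    abel
  · rw [(hγ k).mp hk, map_sub, heckeOp_C, heckeOp_anti h1, smul_sub]
  · rw [map_sub, bar_C, bar_C, bar_anti]

/-- The projection of `𝕋_n` onto the linkage class `γ`. -/
noncomputable def proj {n : ℕ} (γ : Lam n) : Sq n := can γ 1 γ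

theorem maps_proj {n : ℕ} (γ : Lam n) : Maps (proj γ) γ (v (anti γ)) := maps_can_sub fun _ => id

theorem mul_apply_anti {n : ℕ} (η θ : Sq n) (x : Tn n) : (η * θ).1 x = η.1 (θ.1 x) := rfl

theorem Maps.comp {n : ℕ} {η θ : Sq n} {ν : Lam n} {y z : Tn n} (h : Maps η ν y)
    (hz : θ.1 y = z) : Maps (θ * η) ν z :=
  ⟨by rw [mul_apply_anti, h.1, hz], fun ν' hν => by rw [mul_apply_anti, h.2 ν' hν, map_zero]⟩

theorem Maps.mul_proj {n : ℕ} {η : Sq n} {ν : Lam n} {y : Tn n} (h : Maps η ν y) :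
    η * proj ν = η := ((maps_proj ν).comp h.1).unique h

theorem proj_mul_proj {n : ℕ} (γ : Lam n) : proj γ * proj γ = proj γ := (maps_proj γ).mul_proj

theorem proj_mul_proj_of_ne {n : ℕ} {γ ν : Lam n} (h : γ ≠ ν) : proj γ * proj ν = 0 :=
  ((maps_proj ν).comp ((maps_proj γ).2 ν h.symm)).unique ⟨rfl, fun _ _ => rfl⟩

theorem sum_proj (n : ℕ) : ∑ γ : Lam n, proj γ = 1 := by
  refine Sq_ext fun ν => ?_
  have : (∑ γ : Lam n, proj γ).1 (v (anti ν)) = ∑ γ : Lam n, (proj γ).1 (v (anti ν)) := by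
    rw [AddSubmonoidClass.coe_finsetSum, LinearMap.sum_apply]
  rw [this, Finset.sum_eq_single ν (fun γ _ h => (maps_proj γ).2 ν h.symm) (by simp)]
  exact (maps_proj ν).1

/-- The quantum integer `[2]`. -/
noncomputable def two : A := q (-1) + q 1

/-- The quantum integer `[6]`. -/
noncomputable def six : A := two ^ 5 - 4 * two ^ 3 + 3 * two

theorem evalOne_two : evalOne two = 2 := by
  rw [two, map_add, evalOne_q, evalOne_q]; rfl

theorem evalOne_six : evalOne six = 6 := by
  have h4 : evalOne 4 = 4 := map_ofNat evalOne 4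
  have h3 : evalOne 3 = 3 := map_ofNat evalOne 3
  simp [six, evalOne_two, h4, h3]

theorem K_anti {n : ℕ} {γ : Lam n} (h : ∀ k, fixes γ k) :
    K n (v (anti γ)) = six • v (anti γ) := by
  have h0 : ∀ k, C n k (v (anti γ)) = two • v (anti γ) := fun k => C_anti (h k)
  simp only [K_apply, map_smul, h0, six]
  module

theorem C_anti' {n : ℕ} {γ : Lam n} {k : Fin 2} (h : fixes γ k) :
    C n k (v (anti γ)) = two • v (anti γ) := C_anti h

theorem fixes_zero {n : ℕ} (k l : Fin (n + 1)) : fixes s(k, l) 0 ↔ k = l := by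
  have : height 0 (anti s(k, l)) = ((k ⊔ l : Fin (n + 1)) : ℕ) - ((k ⊓ l : Fin (n + 1)) : ℕ) := rfl
  simp only [fixes, decide_eq_true_eq, this, sub_eq_zero, Nat.cast_inj, Fin.val_inj, sup_eq_inf]

theorem fixes_one {n : ℕ} (k l : Fin (n + 1)) : fixes s(k, l) 1 ↔ k = 0 ∨ l = 0 := by
  have : height 1 (anti s(k, l)) = ((k ⊓ l : Fin (n + 1)) : ℕ) := rfl
  simp only [fixes, decide_eq_true_eq, this, Nat.cast_eq_zero, Fin.ext_iff, Fin.val_zero]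
  rcases le_total k l with h | h
  · rw [inf_eq_left.mpr h]; rw [Fin.le_def] at h; omega
  · rw [inf_eq_right.mpr h]; rw [Fin.le_def] at h; omega

/-! ### Steps between blocks and the loops they form. -/

/-- Adjacency in `{0, …, n}`. -/
def Adj {n : ℕ} (i j : Fin (n + 1)) : Prop := (i : ℕ) + 1 = j ∨ (j : ℕ) + 1 = i

theorem Adj.symm {n : ℕ} {i j : Fin (n + 1)} (h : Adj i j) : Adj j i := Or.symm h

/-- `{φ^1}` between the classes of `ε_j + ε_k` and `ε_i + ε_k`. -/
noncomputable def step {n : ℕ} (i j k : Fin (n + 1)) : Sq n := can s(i, k) 1 s(j, k)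

/-- The value of a step is v, K v or C_m v with v = `v (anti s(i, k))`. These operators commute with
`Sq n`, so the projection to (i,k) fixes each of the values. -/
theorem step_block {n : ℕ} {i j : Fin (n + 1)} (h : Adj i j) (k : Fin (n + 1)) :
    proj s(i, k) * step i j k = step i j k ∧ step i j k * proj s(j, k) = step i j k := by
  suffices H : ∃ y, Maps (step i j k) s(j, k) y ∧ (proj s(i, k)).1 y = y by
    obtain ⟨y, hy, hp⟩ := H
    exact ⟨(hy.comp hp).unique hy, hy.mul_proj⟩
  have hv := (maps_proj s(i, k)).1
  by_cases h1 : ∀ m, fixes s(j, k) m → fixes s(i, k) m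
  · exact ⟨_, maps_can_sub h1, hv⟩
  · push Not at h1
    obtain ⟨m, hm, hm'⟩ := h1
    by_cases h2 : ∀ m', fixes s(j, k) m'
    · have hjk := (fixes_zero j k).mp (h2 0)
      subst hjk
      have hj : j = 0 := by simpa using (fixes_one j j).mp (h2 1)
      subst hj
      refine ⟨_, maps_can_full (fun l => ?_) h2, by rw [Sq_K, hv]⟩
      have hi : i ≠ 0 := by rintro rfl; unfold Adj at h; simp at h
      fin_cases l
      · simpa using (fixes_zero i 0).not.mpr hi
      · simpa using (fixes_one i 0).mpr (Or.inr rfl)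
    · refine ⟨_, maps_can_pair (k := m) (by simpa using hm') fun l => ⟨fun hl => ?_, ?_⟩,
        by rw [Sq_C, hv]⟩
      · by_contra hlm
        refine h2 fun m' => ?_
        have : m' = l ∨ m' = m := by omega
        rcases this with rfl | rfl
        · exact hl
        · exact hm
      · rintro rfl; exact hm

/-- The product of two opposite steps. -/
noncomputable def loop {n : ℕ} (i j k : Fin (n + 1)) : Sq n := step i j k * step j i k

theorem loop_block {n : ℕ} {i j : Fin (n + 1)} (h : Adj i j) (k : Fin (n + 1)) :
    proj s(i, k) * loop i j k = loop i j k ∧ loop i j k * proj s(i, k) = loop i j k :=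
  ⟨by rw [loop, ← mul_assoc, (step_block h k).1],
    by rw [loop, mul_assoc, (step_block h.symm k).2]⟩

theorem loop_eq_proj {n : ℕ} {i j k : Fin (n + 1)} (h : ∀ m, fixes s(i, k) m ↔ fixes s(j, k) m) :
    loop i j k = proj s(i, k) :=
  ((maps_can_sub fun m => (h m).mp).comp (maps_can_sub fun m => (h m).mpr).1).unique (maps_proj _)

/-- Leaving the wall and returning applies C_m to a vector that it scales by [2], the quantised
order of the stabilizer. -/
theorem loop_eq_two {n : ℕ} {i j k : Fin (n + 1)} {m : Fin 2}
    (hi : ∀ m', fixes s(i, k) m' ↔ m' = m) (hj : ∀ m', fixes s(j, k) m' = false) :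
    loop i j k = two • proj s(i, k) :=
  ((maps_can_pair (hj m) hi).comp (z := two • v (anti s(i, k))) (by
    have h : Maps (step i j k) s(j, k) (v (anti s(i, k))) :=
      maps_can_sub fun m' => by rw [hj]; simp
    rw [Sq_C, h.1, C_anti' ((hi m).mpr rfl)])).unique ((maps_proj _).smul _)

/-- Here [6] is the quantised index in W of the stabilizer of order two. -/
theorem loop_eq_six {n : ℕ} {i j k : Fin (n + 1)}
    (hi : ∀ m, fixes s(i, k) m) (hj : ∀ m, fixes s(j, k) m ↔ m = 1) :
    loop i j k = six • proj s(i, k) :=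
  ((maps_can_full hj hi).comp (z := six • v (anti s(i, k))) (by
    have h : Maps (step i j k) s(j, k) (v (anti s(i, k))) := maps_can_sub fun m' _ => hi m'
    rw [Sq_K, h.1, K_anti hi])).unique ((maps_proj _).smul _)

/-- On a block without walls, these loops supply the generators of the Hecke algebra. -/
theorem maps_loop_C {n : ℕ} {i j k : Fin (n + 1)} {m : Fin 2}
    (hi : ∀ m', fixes s(i, k) m' = false) (hj : ∀ m', fixes s(j, k) m' ↔ m' = m) :
    Maps (loop i j k) s(i, k) (C n m (v (anti s(i, k)))) :=
  (maps_can_sub (fun m' => by rw [hi]; simp)).comp (maps_can_pair (hi m) hj).1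

/-- This is the loop on (0,1) through (1,1), needed when n = 1. -/
theorem maps_loop_C_C {n : ℕ} {i j k : Fin (n + 1)}
    (hi : ∀ m, fixes s(i, k) m ↔ m = 1) (hj : ∀ m, fixes s(j, k) m ↔ m = 0) :
    Maps (loop i j k) s(i, k) (C n 1 (C n 0 (v (anti s(i, k))))) := by
  have h0 : fixes s(i, k) 0 = false := by simpa using (hi 0).not
  have h1 : fixes s(j, k) 1 = false := by simpa using (hj 1).not
  refine (maps_can_pair h1 hi).comp ?_
  have h : Maps (step i j k) s(j, k) (C n 0 (v (anti s(i, k)))) := maps_can_pair h0 hj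
  rw [Sq_C, h.1]

/-- The operators `e_a` and `f_a`. -/
noncomputable def move {n : ℕ} (i j : Fin (n + 1)) : Sq n := ∑ k, step i j k

theorem step_mul_proj_of_ne {n : ℕ} {i j : Fin (n + 1)} (h : Adj i j) {k : Fin (n + 1)} {γ : Lam n}
    (hγ : s(j, k) ≠ γ) : step i j k * proj γ = 0 := by
  rw [← (step_block h k).2, mul_assoc, proj_mul_proj_of_ne hγ, mul_zero]

theorem move_mul_proj {n : ℕ} {i j : Fin (n + 1)} (h : Adj i j) (k : Fin (n + 1)) :
    move i j * proj s(j, k) = step i j k := by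
  rw [move, Finset.sum_mul, Finset.sum_eq_single k, (step_block h k).2]
  · intro l _ hl
    exact step_mul_proj_of_ne h (Sym2.congr_right.not.mpr hl)
  · simp

theorem move_mul_move {n : ℕ} {i j : Fin (n + 1)} (h : Adj i j) :
    move i j * move j i = ∑ k, loop i j k := by
  conv_lhs => rw [move.eq_def j i]
  rw [Finset.mul_sum]
  refine Finset.sum_congr rfl fun k _ => ?_
  rw [← (step_block h.symm k).1, ← mul_assoc, move_mul_proj h, loop]

/-- For i ≠ i', the unordered pairs {i,k} and {i',l} agree only if k = i' and l = i, so
orthogonality of the projections leaves one term. -/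
theorem sum_loop_mul_sum_loop {n : ℕ} {i j i' j' : Fin (n + 1)} (h : Adj i j) (h' : Adj i' j')
    (hi : i ≠ i') : (∑ k, loop i j k) * (∑ k, loop i' j' k) = loop i j i' * loop i' j' i := by
  have hz : ∀ k l, s(i, k) ≠ s(i', l) → loop i j k * loop i' j' l = 0 := by
    intro k l hkl
    rw [← (loop_block h k).2, ← (loop_block h' l).1, mul_assoc, ← mul_assoc (proj s(i, k)),
      proj_mul_proj_of_ne hkl, zero_mul, mul_zero]
  rw [Finset.sum_mul_sum, Finset.sum_eq_single i', Finset.sum_eq_single i]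
  · intro l _ hl
    exact hz _ _ (by rw [Sym2.eq_swap]; exact Sym2.congr_right.not.mpr hl.symm)
  · simp
  · intro k _ hk
    exact Finset.sum_eq_zero fun l _ => hz _ _ (by simp [hi, hk])
  · simp

/-! ### Generation -/

theorem fixes_iff_forall {n : ℕ} (k l : Fin (n + 1)) (p : Fin 2 → Prop) :
    (∀ m, fixes s(k, l) m ↔ p m) ↔
      (((k : ℕ) = l ↔ p 0) ∧ ((k : ℕ) = 0 ∨ (l : ℕ) = 0 ↔ p 1)) := by
  rw [Fin.forall_fin_two, fixes_zero, fixes_one]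
  simp only [Fin.ext_iff, Fin.val_zero]

theorem fixes_eq_false {n : ℕ} {k l : Fin (n + 1)} (hkl : (k : ℕ) ≠ l) (hk : (k : ℕ) ≠ 0)
    (hl : (l : ℕ) ≠ 0) (m : Fin 2) : fixes s(k, l) m = false := by
  have := (fixes_iff_forall k l fun _ => False).mpr (by simp [hkl, hk, hl]) m
  simpa using this

theorem loop_eq_proj_of_ne {n : ℕ} {i j k : Fin (n + 1)} (hi : (i : ℕ) ≠ 0) (hj : (j : ℕ) ≠ 0)
    (hik : (i : ℕ) ≠ k) (hjk : (j : ℕ) ≠ k) : loop i j k = proj s(i, k) :=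
  loop_eq_proj (by
    rw [fixes_iff_forall, ← Fin.ext_iff, fixes_zero, fixes_one, Fin.ext_iff, Fin.ext_iff,
      Fin.ext_iff]
    simp [hi, hj, hik, hjk])

theorem loop_eq_two_proj_wall {n : ℕ} {i j k : Fin (n + 1)} (hi : (i : ℕ) = 0) (hj : (j : ℕ) ≠ 0)
    (hk : (k : ℕ) ≠ 0) (hjk : (j : ℕ) ≠ k) : loop i j k = two • proj s(i, k) :=
  loop_eq_two (m := 1) (by rw [fixes_iff_forall]; simp [hi, Ne.symm hk])
    (fixes_eq_false hjk hj hk)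

theorem loop_eq_two_proj_diag {n : ℕ} {i j : Fin (n + 1)} (hi : (i : ℕ) ≠ 0) (hj : (j : ℕ) ≠ 0)
    (hij : (j : ℕ) ≠ i) : loop i j i = two • proj s(i, i) :=
  loop_eq_two (m := 0) (by rw [fixes_iff_forall]; simp [hi])
    (fixes_eq_false hij hj hi)

theorem loop_eq_six_proj {n : ℕ} {i j : Fin (n + 1)} (hi : (i : ℕ) = 0) (hj : (j : ℕ) ≠ 0) :
    loop i j i = six • proj s(i, i) :=
  loop_eq_six (fun m => by
      have := (fixes_iff_forall i i fun _ => True).mpr (by simp [hi]) m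
      simpa using this)
    (by rw [fixes_iff_forall]; simp [hi, hj])

theorem maps_loop_zero {n : ℕ} {i j : Fin (n + 1)} (hi : (i : ℕ) ≠ 0) (hj : (j : ℕ) ≠ 0)
    (hij : (i : ℕ) ≠ j) : Maps (loop i j j) s(i, j) (C n 0 (v (anti s(i, j)))) :=
  maps_loop_C (fixes_eq_false hij hi hj) (by rw [fixes_iff_forall]; simp [hj])

theorem maps_loop_one {n : ℕ} {i j k : Fin (n + 1)} (hi : (i : ℕ) ≠ 0) (hj : (j : ℕ) = 0)
    (hk : (k : ℕ) ≠ 0) (hik : (i : ℕ) ≠ k) :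
    Maps (loop i j k) s(i, k) (C n 1 (v (anti s(i, k)))) :=
  maps_loop_C (fixes_eq_false hik hi hk) (by rw [fixes_iff_forall]; simp [hj, Ne.symm hk])

/-- `R` contains `x` as soon as it contains a multiple `c x` with `c(1) ≠ 0`. -/
def Saturated {n : ℕ} (R : Subalgebra A (Sq n)) : Prop :=
  ∀ (c : A) (x : Sq n), evalOne c ≠ 0 → c • x ∈ R → x ∈ R

theorem evalOne_two_ne : evalOne two ≠ 0 := by rw [evalOne_two]; decide

theorem evalOne_six_ne : evalOne six ≠ 0 := by rw [evalOne_six]; decide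

theorem mem_of_add_mem {n : ℕ} {R : Subalgebra A (Sq n)} {x y : Sq n} (h : x + y ∈ R)
    (hy : y ∈ R) : x ∈ R := by
  have e : x + y + (-1 : A) • y = x := Subtype.ext (by
    change x.1 + y.1 + (-1 : A) • y.1 = x.1
    module)
  rw [← e]
  exact R.add_mem h (R.smul_mem hy _)

theorem mem_of_sum_mem {n : ℕ} {ι : Type*} [Fintype ι] [DecidableEq ι] {R : Subalgebra A (Sq n)}
    {x : ι → Sq n} (h : ∑ k, x k ∈ R) (a : ι) (ha : ∀ k, k ≠ a → x k ∈ R) : x a ∈ R := by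
  rw [← Finset.add_sum_erase _ _ (Finset.mem_univ a)] at h
  exact mem_of_add_mem h (R.sum_mem fun k hk => ha k (Finset.ne_of_mem_erase hk))

theorem add_mem_of_sum_mem {n : ℕ} {ι : Type*} [Fintype ι] [DecidableEq ι]
    {R : Subalgebra A (Sq n)} {x : ι → Sq n} (h : ∑ k, x k ∈ R) {a b : ι} (hab : b ≠ a)
    (ha : ∀ k, k ≠ a → k ≠ b → x k ∈ R) : x a + x b ∈ R := by
  rw [← Finset.add_sum_erase _ _ (Finset.mem_univ a),
    ← Finset.add_sum_erase _ _ (Finset.mem_erase.mpr ⟨hab, Finset.mem_univ b⟩), ← add_assoc] at h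
  exact mem_of_add_mem h (R.sum_mem fun k hk => ha k
    (Finset.ne_of_mem_erase (Finset.mem_of_mem_erase hk)) (Finset.ne_of_mem_erase hk))

section

variable {n : ℕ} {R : Subalgebra A (Sq n)}

/-- With x = c p + r one has x² − x = c(c − 1) p, and c(c − 1) does not vanish at q = 1. -/
theorem mem_of_orthogonal (hR : Saturated R) {p r : Sq n} {c : A} (hp : p * p = p) (hr : r * r = r)
    (hpr : p * r = 0) (hrp : r * p = 0) (hc : evalOne c ≠ 0) (hc' : evalOne c ≠ 1)
    (h : c • p + r ∈ R) : p ∈ R ∧ r ∈ R := by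
  have h1 : (c • p + r) * (c • p + r) = (c * (c - 1)) • p + (c • p + r) := by
    simp only [add_mul, mul_add, smul_mul_assoc, mul_smul_comm, hp, hr, hpr, hrp, smul_zero,
      zero_add, add_zero, smul_smul]
    rw [← add_assoc, ← add_smul]
    congr 2
    ring
  have h2 : p ∈ R := by
    refine hR (c * (c - 1)) p ?_ (mem_of_add_mem (h1 ▸ R.mul_mem h h) h)
    rw [map_mul, map_sub, map_one]
    exact mul_ne_zero hc (sub_ne_zero.mpr hc')
  rw [add_comm] at h
  exact ⟨h2, mem_of_add_mem h (R.smul_mem h2 c)⟩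

theorem sum_loop_mem (hmove : ∀ i j : Fin (n + 1), Adj i j → move i j ∈ R) {i j : Fin (n + 1)}
    (h : Adj i j) : ∑ k, loop i j k ∈ R := by
  rw [← move_mul_move h]
  exact R.mul_mem (hmove i j h) (hmove j i h.symm)

theorem loop_mul_loop_mem (hmove : ∀ i j : Fin (n + 1), Adj i j → move i j ∈ R)
    {i j i' j' : Fin (n + 1)} (h : Adj i j) (h' : Adj i' j') (hi : i ≠ i') :
    loop i j i' * loop i' j' i ∈ R := by
  rw [← sum_loop_mul_sum_loop h h' hi]
  exact R.mul_mem (sum_loop_mem hmove h) (sum_loop_mem hmove h')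

/-- Raising k and lowering l by one meets no diagonal block when k + 1 < l, so both loops on (k,l)
are scalar: 1, except for [2] at k = 0. -/
theorem proj_mem_of_lt (hR : Saturated R)
    (hmove : ∀ i j : Fin (n + 1), Adj i j → move i j ∈ R) {k l : Fin (n + 1)}
    (h : (k : ℕ) + 1 < l) : proj s(k, l) ∈ R := by
  have hl := l.2
  let j : Fin (n + 1) := ⟨k + 1, by omega⟩
  let j' : Fin (n + 1) := ⟨l - 1, by omega⟩
  have hj : Adj k j := Or.inl rfl
  have hj' : Adj l j' := Or.inr (by simp only [j']; omega)
  have hm := loop_mul_loop_mem hmove hj hj' (by rintro rfl; omega)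
  rw [loop_eq_proj_of_ne (i := l) (j := j') (k := k) (by omega) (by simp only [j']; omega)
    (by omega) (by simp only [j']; omega), Sym2.eq_swap, (loop_block hj l).2] at hm
  by_cases hk : (k : ℕ) = 0
  · rw [loop_eq_two_proj_wall hk (by simp [j]) (by omega) (by simp only [j]; omega)] at hm
    exact hR _ _ evalOne_two_ne hm
  · rwa [loop_eq_proj_of_ne hk (by simp [j]) (by omega) (by simp only [j]; omega)] at hm

theorem proj_mem_of_far (hR : Saturated R)
    (hmove : ∀ i j : Fin (n + 1), Adj i j → move i j ∈ R) {k l : Fin (n + 1)}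
    (h : (k : ℕ) + 1 < l ∨ (l : ℕ) + 1 < k) : proj s(k, l) ∈ R := by
  rcases h with h | h
  · exact proj_mem_of_lt hR hmove h
  · rw [Sym2.eq_swap]
    exact proj_mem_of_lt hR hmove h

/-- If i = 0, then j = 1, and the loop on (1,0) through (2,0) is the projection; this is where n ≥ 2
enters. Otherwise the loops on (i,j) through (j,j) and (i,i) both act as C_0, and their product is
[2] times either. -/
theorem loop_mem (hn : 2 ≤ n) (hR : Saturated R)
    (hmove : ∀ i j : Fin (n + 1), Adj i j → move i j ∈ R) {i j : Fin (n + 1)}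
    (h : Adj i j) (hj : (j : ℕ) ≠ 0) : loop i j j ∈ R := by
  have hij : (i : ℕ) ≠ j := by rcases h with h | h <;> omega
  have hne : i ≠ j := fun h => hij (congrArg _ h)
  by_cases hi : (i : ℕ) = 0
  · have hj1 : (j : ℕ) = 1 := by rcases h with h | h <;> omega
    have h2 : Adj j (⟨2, by omega⟩ : Fin (n + 1)) := Or.inl (by simp [hj1])
    have hm := loop_mul_loop_mem hmove h h2 hne
    rwa [loop_eq_proj_of_ne hj (by simp) (by omega) (by simp [hi]), Sym2.eq_swap,
      (loop_block h j).2] at hm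
  · have hm := loop_mul_loop_mem hmove h h.symm hne
    have h1 := maps_loop_zero hi hj hij
    have h2 := maps_loop_zero hj hi hij.symm
    rw [Sym2.eq_swap] at h2
    have h3 : loop i j j * loop j i i = two • loop i j j :=
      (h2.comp (z := two • C n 0 (v (anti s(i, j)))) (by rw [Sq_C, h1.1, C_C]; rfl)).unique
        (h1.smul two)
    rw [h3] at hm
    exact hR _ _ evalOne_two_ne hm

theorem proj_ne {n : ℕ} {γ ν : Lam n} (h : γ ≠ ν) :
    proj γ * proj ν = 0 ∧ proj ν * proj γ = 0 :=
  ⟨proj_mul_proj_of_ne h, proj_mul_proj_of_ne h.symm⟩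

/-- In the loop sum at i through i + 1 the distant blocks and (i,i+1) are already known. What
remains is [2] times the projection to (i,i) plus the projection to (i,i−1). -/
theorem proj_mem_diag_and_pred (hn : 2 ≤ n) (hR : Saturated R)
    (hmove : ∀ i j : Fin (n + 1), Adj i j → move i j ∈ R) {h i : Fin (n + 1)}
    (hi : (h : ℕ) + 1 = i) (hin : (i : ℕ) < n) : proj s(i, i) ∈ R ∧ proj s(i, h) ∈ R := by
  let j : Fin (n + 1) := ⟨i + 1, by omega⟩
  have hj : Adj i j := Or.inl rfl
  have hhi : h ≠ i := by rintro rfl; omega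
  have hs := add_mem_of_sum_mem (sum_loop_mem hmove hj) hhi (by
    intro k hki hkh
    by_cases hkj : k = j
    · rw [hkj]
      exact loop_mem hn hR hmove hj (by simp [j])
    · simp only [ne_eq, Fin.ext_iff, j] at hki hkh hkj
      rw [loop_eq_proj_of_ne (by omega) (by simp [j]) (Ne.symm hki) (Ne.symm hkj)]
      exact proj_mem_of_far hR hmove (by omega))
  rw [loop_eq_two_proj_diag (by omega) (by simp [j]) (by simp [j]),
    loop_eq_proj_of_ne (by omega) (by simp [j]) (by omega) (by simp only [j]; omega)] at hs
  have hne : s(i, i) ≠ s(i, h) := Sym2.congr_right.not.mpr hhi.symm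
  exact mem_of_orthogonal hR (proj_mul_proj _) (proj_mul_proj _) (proj_ne hne).1 (proj_ne hne).2
    evalOne_two_ne (by rw [evalOne_two]; decide) hs

/-- In the loop sum at 0 through 1, only the term [6] times the projection to (0,0) is not yet
known. -/
theorem proj_mem_zero (hn : 2 ≤ n) (hR : Saturated R)
    (hmove : ∀ i j : Fin (n + 1), Adj i j → move i j ∈ R) :
    proj s((0 : Fin (n + 1)), 0) ∈ R := by
  let j : Fin (n + 1) := ⟨1, by omega⟩
  have hj : Adj 0 j := Or.inl rfl
  have hs := mem_of_sum_mem (sum_loop_mem hmove hj) 0 (by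
    intro k hk
    by_cases hkj : k = j
    · rw [hkj]
      exact loop_mem hn hR hmove hj (by simp [j])
    · simp only [ne_eq, Fin.ext_iff, j, Fin.val_zero] at hk hkj
      rw [loop_eq_two_proj_wall rfl (by simp [j]) hk (Ne.symm hkj)]
      exact R.smul_mem (proj_mem_of_far hR hmove (Or.inl (by simp only [Fin.val_zero]; omega))) _)
  rw [loop_eq_six_proj rfl (by simp [j])] at hs
  exact hR _ _ evalOne_six_ne hs

theorem proj_mem_last (hn : 2 ≤ n) (hR : Saturated R)
    (hmove : ∀ i j : Fin (n + 1), Adj i j → move i j ∈ R) :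
    proj s(Fin.last n, Fin.last n) ∈ R := by
  let j : Fin (n + 1) := ⟨n - 1, by omega⟩
  have hj : Adj (Fin.last n) j := Or.inr (by simp only [j, Fin.val_last]; omega)
  have hj0 : (j : ℕ) ≠ 0 := by simp only [j]; omega
  have hl0 : (Fin.last n : ℕ) ≠ 0 := by simp only [Fin.val_last]; omega
  have hs := mem_of_sum_mem (sum_loop_mem hmove hj) (Fin.last n) (by
    intro k hk
    by_cases hkj : k = j
    · rw [hkj]
      exact loop_mem hn hR hmove hj hj0
    · have := k.2
      simp only [ne_eq, Fin.ext_iff, j] at hk hkj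
      rw [loop_eq_proj_of_ne hl0 hj0 (Ne.symm hk) (Ne.symm hkj)]
      rw [Fin.val_last] at hk
      exact proj_mem_of_far hR hmove (Or.inr (by rw [Fin.val_last]; omega)))
  rw [loop_eq_two_proj_diag hl0 hj0 (by simp only [j, Fin.val_last]; omega)] at hs
  exact hR _ _ evalOne_two_ne hs

theorem proj_mem (hn : 2 ≤ n) (hR : Saturated R)
    (hmove : ∀ i j : Fin (n + 1), Adj i j → move i j ∈ R) (γ : Lam n) : proj γ ∈ R := by
  let j : Fin (n + 1) := ⟨n - 1, by omega⟩
  have hle : ∀ k l : Fin (n + 1), k ≤ l → s(k, l) ≠ s(j, Fin.last n) → proj s(k, l) ∈ R := by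
    intro k l hkl hne
    rw [Fin.le_def] at hkl
    have hl := l.2
    by_cases h1 : (k : ℕ) + 1 < l
    · exact proj_mem_of_lt hR hmove h1
    by_cases h2 : k = l
    · subst h2
      by_cases hk0 : k = 0
      · rw [hk0]; exact proj_mem_zero hn hR hmove
      by_cases hkn : k = Fin.last n
      · rw [hkn]; exact proj_mem_last hn hR hmove
      simp only [Fin.ext_iff, Fin.val_zero, Fin.val_last] at hk0 hkn
      exact (proj_mem_diag_and_pred hn hR hmove (h := ⟨k - 1, by omega⟩) (i := k)
        (by simp only; omega) (by omega)).1
    · rw [Fin.ext_iff] at h2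
      have h3 : (k : ℕ) + 1 = l := by omega
      have h4 : (l : ℕ) < n := by
        by_contra h4
        have e1 : k = j := Fin.ext (by simp only [j]; omega)
        have e2 : l = Fin.last n := Fin.ext (by simp only [Fin.val_last]; omega)
        exact hne (by rw [e1, e2])
      rw [Sym2.eq_swap]
      exact (proj_mem_diag_and_pred hn hR hmove h3 h4).2
  have hne : ∀ γ : Lam n, γ ≠ s(j, Fin.last n) → proj γ ∈ R := by
    intro γ
    induction γ using Sym2.ind with
    | _ k l =>
      rcases le_total k l with h | h
      · exact hle k l h
      · rw [Sym2.eq_swap]; exact hle l k h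
  by_cases h : γ = s(j, Fin.last n)
  · rw [h]
    -- The last projection, to (n−1,n), is 1 minus all the others.
    refine mem_of_sum_mem (x := fun γ : Lam n => proj γ) ?_ _ hne
    rw [sum_proj]
    exact R.one_mem
  · exact hne γ h

end

/-! ### Endomorphisms of one block and factorisation through it. -/

theorem C_stable_eq_top {n : ℕ} (N : Submodule A (Tn n)) (h0 : ∀ γ, v (anti γ) ∈ N)
    (hN : ∀ k, ∀ x ∈ N, C n k x ∈ N) : N = ⊤ :=
  submodule_eq_top N h0 fun k x hx => by
    rw [heckeOp_eq]
    exact N.sub_mem (hN k x hx) (N.smul_mem _ hx)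

section

variable {n : ℕ} {R : Subalgebra A (Sq n)}

/-- The vectors whose γ-component has the form η(v) with η ∈ R and v = `v (anti γ)` are stable under
C_k, because C_k η(v) = η(C_k v) = (η L_k)(v). They contain the generators of `𝕋_n`, so R reaches
every endomorphism of the block. -/
theorem corner_mem {γ : Lam n} (hp : proj γ ∈ R) (L : Fin 2 → Sq n) (hLR : ∀ k, L k ∈ R)
    (hL : ∀ k, (L k).1 (v (anti γ)) = C n k (v (anti γ))) (x : Sq n) :
    proj γ * x * proj γ ∈ R := by
  let N : Submodule A (Tn n) :=
    { carrier := {y | ∃ η ∈ R, η.1 (v (anti γ)) = (proj γ).1 y}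
      add_mem' := by
        rintro y z ⟨η, hη, h⟩ ⟨θ, hθ, h'⟩
        exact ⟨η + θ, R.add_mem hη hθ, by
          change η.1 _ + θ.1 _ = _
          rw [h, h', map_add]⟩
      zero_mem' := ⟨0, R.zero_mem, by rw [map_zero]; rfl⟩
      smul_mem' := by
        rintro c y ⟨η, hη, h⟩
        exact ⟨c • η, R.smul_mem hη c, by
          change c • η.1 _ = _
          rw [h, map_smul]⟩ }
  have hN : N = ⊤ := by
    refine C_stable_eq_top N (fun ν => ?_) ?_
    · by_cases h : ν = γ
      · exact ⟨proj γ, hp, by rw [h]⟩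
      · exact ⟨0, R.zero_mem, by rw [(maps_proj γ).2 ν h]; rfl⟩
    · rintro k y ⟨η, hη, h⟩
      exact ⟨η * L k, R.mul_mem hη (hLR k), by rw [mul_apply_anti, hL, Sq_C, h, Sq_C]⟩
  obtain ⟨η, hη, h⟩ : x.1 (v (anti γ)) ∈ N := hN ▸ trivial
  have h1 : proj γ * x * proj γ = η * proj γ :=
    ((maps_proj γ).comp (z := (proj γ).1 (x.1 (v (anti γ)))) rfl).unique ((maps_proj γ).comp h)
  rw [h1]
  exact R.mul_mem hη hp

/-- The projection to `γ` factors, up to a scalar, through the linkage class `ν` within `R`. -/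
def Link (R : Subalgebra A (Sq n)) (γ ν : Lam n) : Prop :=
  ∃ p ∈ R, ∃ i ∈ R, ∃ c : A, evalOne c ≠ 0 ∧ p * proj ν * i = c • proj γ

theorem Link.refl {γ : Lam n} : Link R γ γ :=
  ⟨1, R.one_mem, 1, R.one_mem, 1, by simp, by simp⟩

theorem Link.trans {γ ν μ : Lam n} (h : Link R γ ν) (h' : Link R ν μ) : Link R γ μ := by
  obtain ⟨p, hp, i, hi, c, hc, h⟩ := h
  obtain ⟨p', hp', i', hi', c', hc', h'⟩ := h'
  refine ⟨p * p', R.mul_mem hp hp', i' * i, R.mul_mem hi' hi, c' * c, ?_, ?_⟩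
  · rw [map_mul]; exact mul_ne_zero hc' hc
  · calc p * p' * proj μ * (i' * i) = p * (p' * proj μ * i') * i := by simp only [mul_assoc]
      _ = (c' * c) • proj γ := by
        rw [h', mul_smul_comm, smul_mul_assoc, h, smul_smul]

/-- Each component `proj γ * x * proj ν` factors, up to a scalar, through the corner at γ₀. -/
theorem eq_top_of_link (hR : Saturated R) (γ₀ : Lam n)
    (h : ∀ x : Sq n, proj γ₀ * x * proj γ₀ ∈ R) (hl : ∀ γ, Link R γ γ₀) : R = ⊤ := by
  rw [eq_top_iff]
  intro x _
  rw [← one_mul x, ← mul_one (1 * x), ← sum_proj, Finset.sum_mul, Finset.sum_mul]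
  refine R.sum_mem fun γ _ => ?_
  rw [Finset.mul_sum]
  refine R.sum_mem fun ν _ => ?_
  obtain ⟨p, hp, i, hi, c, hc, e⟩ := hl γ
  obtain ⟨p', hp', i', hi', c', hc', e'⟩ := hl ν
  refine hR (c * c') _ (by rw [map_mul]; exact mul_ne_zero hc hc') ?_
  have : (c * c') • (proj γ * x * proj ν) = p * (proj γ₀ * (i * x * p') * proj γ₀) * i' := by
    calc (c * c') • (proj γ * x * proj ν) = (c • proj γ) * x * (c' • proj ν) := by
          simp only [smul_mul_assoc, mul_smul_comm, smul_smul, mul_comm]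
      _ = p * (proj γ₀ * (i * x * p') * proj γ₀) * i' := by
          rw [← e, ← e']
          simp only [mul_assoc]
  rw [this]
  exact R.mul_mem (R.mul_mem hp (h _)) hi'

theorem step_mem (hmove : ∀ i j : Fin (n + 1), Adj i j → move i j ∈ R)
    (hproj : ∀ γ : Lam n, proj γ ∈ R) {i j : Fin (n + 1)} (h : Adj i j) (k : Fin (n + 1)) :
    step i j k ∈ R := by
  rw [← move_mul_proj h]
  exact R.mul_mem (hmove i j h) (hproj _)

theorem link_of_loop (hstep : ∀ i j k : Fin (n + 1), Adj i j → step i j k ∈ R)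
    {i j k : Fin (n + 1)} (h : Adj i j) {c : A} (hc : evalOne c ≠ 0)
    (hl : loop i j k = c • proj s(i, k)) : Link R s(i, k) s(j, k) :=
  ⟨step i j k, hstep i j k h, step j i k, hstep j i k h.symm, c, hc, by
    rw [(step_block h k).2, ← hl, loop]⟩

theorem link_of_loop_one (hstep : ∀ i j k : Fin (n + 1), Adj i j → step i j k ∈ R)
    {i j k : Fin (n + 1)} (h : Adj i j) (hl : loop i j k = proj s(i, k)) :
    Link R s(i, k) s(j, k) :=
  link_of_loop hstep h (c := 1) (by simp) (by rw [hl, one_smul])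

/-- Lower k to 1, then l to 2. The indices stay nonzero and distinct, so all loops used are
projections. -/
theorem link_regular (hstep : ∀ i j k : Fin (n + 1), Adj i j → step i j k ∈ R)
    {a b : Fin (n + 1)} (ha : (a : ℕ) = 1) (hb : (b : ℕ) = 2) (m : ℕ) :
    ∀ k l : Fin (n + 1), (k : ℕ) + l = m → (k : ℕ) ≠ 0 → (k : ℕ) < l → Link R s(k, l) s(a, b) := by
  induction m with
  | zero => intro k l h; omega
  | succ m ih =>
    intro k l h hk hkl
    have hl := l.2
    by_cases hk1 : (k : ℕ) = 1
    · by_cases hl2 : (l : ℕ) = 2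
      · rw [show k = a from Fin.ext (by omega), show l = b from Fin.ext (by omega)]
        exact Link.refl
      · let j : Fin (n + 1) := ⟨l - 1, by omega⟩
        have hj : (j : ℕ) = l - 1 := rfl
        have h1 : Link R s(l, k) s(j, k) := link_of_loop_one hstep (Or.inr (by omega))
          (loop_eq_proj_of_ne (by omega) (by omega) (by omega) (by omega))
        rw [Sym2.eq_swap, Sym2.eq_swap (a := j)] at h1
        exact h1.trans (ih k j (by omega) hk (by omega))
    · let j : Fin (n + 1) := ⟨k - 1, by omega⟩
      have hj : (j : ℕ) = k - 1 := rfl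
      have h1 : Link R s(k, l) s(j, l) := link_of_loop_one hstep (Or.inr (by omega))
        (loop_eq_proj_of_ne (by omega) (by omega) (by omega) (by omega))
      exact h1.trans (ih j l (by omega) (by omega) (by omega))

/-- Every block reaches (1,2) by steps that never enter a new wall, so that the loops are scalars 1,
[2] or [6]. -/
theorem link_all (hstep : ∀ i j k : Fin (n + 1), Adj i j → step i j k ∈ R)
    {a b : Fin (n + 1)} (ha : (a : ℕ) = 1) (hb : (b : ℕ) = 2) (γ : Lam n) :
    Link R γ s(a, b) := by
  have hreg : ∀ k l : Fin (n + 1), (k : ℕ) ≠ 0 → (k : ℕ) < l → Link R s(k, l) s(a, b) :=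
    fun k l => link_regular hstep ha hb _ k l rfl
  have hbn := b.2
  have h02 : ∀ k l : Fin (n + 1), (k : ℕ) = 0 → 2 ≤ (l : ℕ) → Link R s(k, l) s(a, b) := by
    intro k l hk hl
    have h1 : Link R s(k, l) s(a, l) := link_of_loop hstep (Or.inl (by omega)) evalOne_two_ne
      (loop_eq_two_proj_wall hk (by omega) (by omega) (by omega))
    exact h1.trans (hreg a l (by omega) (by omega))
  have h01 : ∀ k l : Fin (n + 1), (k : ℕ) = 0 → (l : ℕ) = 1 → Link R s(k, l) s(a, b) := by
    intro k l hk hl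
    have h1 : Link R s(l, k) s(b, k) := link_of_loop_one hstep (Or.inl (by omega))
      (loop_eq_proj_of_ne (by omega) (by omega) (by omega) (by omega))
    rw [Sym2.eq_swap, Sym2.eq_swap (a := b)] at h1
    exact h1.trans (h02 k b hk (by omega))
  have h00 : ∀ k : Fin (n + 1), (k : ℕ) = 0 → Link R s(k, k) s(a, b) := by
    intro k hk
    have h1 : Link R s(k, k) s(a, k) := link_of_loop hstep (Or.inl (by omega)) evalOne_six_ne
      (loop_eq_six_proj hk (by omega))
    rw [Sym2.eq_swap (a := a)] at h1
    exact h1.trans (h01 k a hk ha)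
  have hdiag : ∀ k : Fin (n + 1), (k : ℕ) ≠ 0 → Link R s(k, k) s(a, b) := by
    intro k hk
    by_cases hk1 : (k : ℕ) = 1
    · have h1 : Link R s(k, k) s(b, k) := link_of_loop hstep (Or.inl (by omega)) evalOne_two_ne
        (loop_eq_two_proj_diag hk (by omega) (by omega))
      rw [Sym2.eq_swap (a := b)] at h1
      exact h1.trans (hreg k b hk (by omega))
    · have hk2 := k.2
      let j : Fin (n + 1) := ⟨k - 1, by omega⟩
      have hj : (j : ℕ) = k - 1 := rfl
      have h1 : Link R s(k, k) s(j, k) := link_of_loop hstep (Or.inr (by omega)) evalOne_two_ne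
        (loop_eq_two_proj_diag hk (by omega) (by omega))
      exact h1.trans (hreg j k (by omega) (by omega))
  have hle : ∀ k l : Fin (n + 1), (k : ℕ) ≤ l → Link R s(k, l) s(a, b) := by
    intro k l hkl
    by_cases hkl' : k = l
    · subst hkl'
      by_cases hk : (k : ℕ) = 0
      · exact h00 k hk
      · exact hdiag k hk
    · rw [Fin.ext_iff] at hkl'
      by_cases hk : (k : ℕ) = 0
      · by_cases hl : (l : ℕ) = 1
        · exact h01 k l hk hl
        · exact h02 k l hk (by omega)
      · exact hreg k l hk (by omega)
  induction γ using Sym2.ind with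
  | _ k l =>
    rcases le_total k l with h | h
    · exact hle k l h
    · rw [Sym2.eq_swap]; exact hle l k h

theorem eq_top_of_two_le (hn : 2 ≤ n) (hR : Saturated R)
    (hmove : ∀ i j : Fin (n + 1), Adj i j → move i j ∈ R) : R = ⊤ := by
  have hproj := proj_mem hn hR hmove
  have hstep : ∀ i j k : Fin (n + 1), Adj i j → step i j k ∈ R :=
    fun i j k h => step_mem hmove hproj h k
  have hloop : ∀ i j k : Fin (n + 1), Adj i j → loop i j k ∈ R :=
    fun i j k h => R.mul_mem (hstep i j k h) (hstep j i k h.symm)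
  let o : Fin (n + 1) := ⟨0, by omega⟩
  let a : Fin (n + 1) := ⟨1, by omega⟩
  let b : Fin (n + 1) := ⟨2, by omega⟩
  have hab : Adj a b := Or.inl rfl
  have hao : Adj a o := Or.inr rfl
  refine eq_top_of_link hR s(a, b) (corner_mem (hproj _) ![loop a b b, loop a o b] ?_ ?_)
    (link_all hstep rfl rfl)
  · rw [Fin.forall_fin_two]
    exact ⟨hloop _ _ _ hab, hloop _ _ _ hao⟩
  · rw [Fin.forall_fin_two]
    exact ⟨(maps_loop_zero (by simp [a]) (by simp [b]) (by simp [a, b])).1,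
      (maps_loop_one (by simp [a]) rfl (by simp [b]) (by simp [a, b])).1⟩

end

/-! ### The cases n = 0 and n = 1, and the assembly. -/

theorem eq_top_zero (R : Subalgebra A (Sq 0)) : R = ⊤ := by
  have hγ : ∀ γ : Lam 0, γ = s(0, 0) := by decide
  have hp : proj s((0 : Fin 1), 0) = 1 := by
    rw [← sum_proj, Fintype.sum_eq_single _ fun γ h => absurd (hγ γ) h]
  -- The only block is fixed by all of W, so both C_k act on its generator as [2], and scalars can
  -- serve as the loops.
  have h := corner_mem (R := R) (γ := s(0, 0)) (hp ▸ R.one_mem) (fun _ => two • 1)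
    (fun _ => R.smul_mem R.one_mem _) (fun k => (C_anti' (by
      fin_cases k
      · exact (fixes_zero _ _).mpr rfl
      · exact (fixes_one _ _).mpr (Or.inl rfl))).symm)
  rw [eq_top_iff]
  intro x _
  simpa [hp] using h x

theorem t_one : t 1 = can s((0 : Fin 2), 1) (s 0) s((0 : Fin 2), 1) := by
  simp [t, Fin.sum_univ_two]

/-- The loop on (0,1) through (1,1) acts as C_1 C_0, which is `t` plus the projection. Subtracting
`t` from the loop sum at 0 leaves [6] p₀₀ + p₀₁, which splits by squaring. -/
theorem proj_mem_one {R : Subalgebra A (Sq 1)} (hR : Saturated R)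
    (hmove : ∀ i j : Fin 2, Adj i j → move i j ∈ R) (ht : t 1 ∈ R) :
    ∀ γ : Lam 1, proj γ ∈ R := by
  have h01 : Adj (0 : Fin 2) 1 := Or.inl rfl
  have f00 : ∀ m, fixes s((0 : Fin 2), 0) m := by
    rw [Fin.forall_fin_two, fixes_zero, fixes_one]; simp
  have f01 : ∀ m, fixes s((0 : Fin 2), 1) m ↔ m = 1 := by
    rw [Fin.forall_fin_two, fixes_zero, fixes_one]; simp
  have f11 : ∀ m, fixes s((1 : Fin 2), 1) m ↔ m = 0 := by
    rw [Fin.forall_fin_two, fixes_zero, fixes_one]; simp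
  have hne : s((0 : Fin 2), 0) ≠ s(0, 1) := by decide
  have hsum : ∑ k, loop (0 : Fin 2) 1 k = six • proj s(0, 0) + proj s(0, 1) + t 1 := by
    have h1 : loop (0 : Fin 2) 1 1 = t 1 + proj s(0, 1) := by
      have h2 := (maps_can_s_wall f01).add (maps_proj s((0 : Fin 2), 1))
      rw [sub_add_cancel, ← t_one] at h2
      exact (maps_loop_C_C f01 f11).unique h2
    rw [Fin.sum_univ_two, loop_eq_six_proj rfl (by decide), h1, add_assoc, add_comm (t 1)]
  have hD := mem_of_add_mem (hsum ▸ sum_loop_mem hmove h01) ht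
  obtain ⟨p00, p01⟩ := mem_of_orthogonal hR (proj_mul_proj _) (proj_mul_proj _) (proj_ne hne).1
    (proj_ne hne).2 evalOne_six_ne (by rw [evalOne_six]; decide) hD
  have hcases : ∀ γ : Lam 1, γ ≠ s(1, 1) → γ = s(0, 0) ∨ γ = s(0, 1) := by decide
  have hne : ∀ γ : Lam 1, γ ≠ s(1, 1) → proj γ ∈ R := by
    intro γ hγ
    rcases hcases γ hγ with rfl | rfl
    · exact p00
    · exact p01
  intro γ
  by_cases h : γ = s(1, 1)
  · rw [h]
    refine mem_of_sum_mem (x := fun γ : Lam 1 => proj γ) ?_ _ hne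
    rw [sum_proj]
    exact R.one_mem
  · exact hne γ h

/-- Each C_k maps `𝕋_1` to eigenvectors for a single wall. The submodule N of those y for which C_1
y and C_0 y are values of R at (0,1) and (1,1) is stable under both C_k, since the steps between
these two blocks exchange the two conditions. -/
theorem eq_top_one {R : Subalgebra A (Sq 1)} (hR : Saturated R)
    (hproj : ∀ γ : Lam 1, proj γ ∈ R)
    (hstep : ∀ i j k : Fin 2, Adj i j → step i j k ∈ R) : R = ⊤ := by
  have h01 : Adj (0 : Fin 2) 1 := Or.inl rfl
  have f00 : ∀ m, fixes s((0 : Fin 2), 0) m := by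
    rw [Fin.forall_fin_two, fixes_zero, fixes_one]; simp
  have f01 : ∀ m, fixes s((0 : Fin 2), 1) m ↔ m = 1 := by
    rw [Fin.forall_fin_two, fixes_zero, fixes_one]; simp
  have f11 : ∀ m, fixes s((1 : Fin 2), 1) m ↔ m = 0 := by
    rw [Fin.forall_fin_two, fixes_zero, fixes_one]; simp
  have m01 : Maps (step (0 : Fin 2) 1 1) s(1, 1) (C 1 0 (v (anti s(0, 1)))) :=
    maps_can_pair (by simpa using (f01 0).not) f11
  have m10 : Maps (step (1 : Fin 2) 0 1) s(0, 1) (C 1 1 (v (anti s(1, 1)))) :=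
    maps_can_pair (by simpa using (f11 1).not) f01
  have m00 : Maps (step (0 : Fin 2) 1 0) s(1, 0) (v (anti s(0, 0))) :=
    maps_can_sub fun m _ => f00 m
  rw [Sym2.eq_swap] at m00
  have hcases : ∀ γ : Lam 1, γ = s(0, 0) ∨ γ = s(0, 1) ∨ γ = s(1, 1) := by decide
  let N : Submodule A (Tn 1) :=
    { carrier := {y | (∃ η ∈ R, η.1 (v (anti s(0, 1))) = C 1 1 y) ∧
        ∃ η ∈ R, η.1 (v (anti s(1, 1))) = C 1 0 y}
      add_mem' := by
        rintro y z ⟨⟨η, hη, h⟩, η', hη', h'⟩ ⟨⟨θ, hθ, i⟩, θ', hθ', i'⟩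
        refine ⟨⟨η + θ, R.add_mem hη hθ, ?_⟩, η' + θ', R.add_mem hη' hθ', ?_⟩
        · change η.1 _ + θ.1 _ = _
          rw [h, i, map_add]
        · change η'.1 _ + θ'.1 _ = _
          rw [h', i', map_add]
      zero_mem' := ⟨⟨0, R.zero_mem, by rw [map_zero]; rfl⟩, 0, R.zero_mem, by rw [map_zero]; rfl⟩
      smul_mem' := by
        rintro c y ⟨⟨η, hη, h⟩, η', hη', h'⟩
        refine ⟨⟨c • η, R.smul_mem hη c, ?_⟩, c • η', R.smul_mem hη' c, ?_⟩
        · change c • η.1 _ = _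
          rw [h, map_smul]
        · change c • η'.1 _ = _
          rw [h', map_smul] }
  have hN : N = ⊤ := by
    refine C_stable_eq_top N (fun γ => ?_) ?_
    · rcases hcases γ with rfl | rfl | rfl
      · refine ⟨⟨two • step 0 1 0, R.smul_mem (hstep _ _ _ h01) _, ?_⟩,
          step 0 1 0 * step 0 1 1, R.mul_mem (hstep _ _ _ h01) (hstep _ _ _ h01), ?_⟩
        · rw [(m00.smul two).1, C_anti' (f00 1)]
        · rw [mul_apply_anti, m01.1, Sq_C, m00.1]
      · exact ⟨⟨two • 1, R.smul_mem R.one_mem _, (C_anti' ((f01 1).mpr rfl)).symm⟩,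
          step 0 1 1, hstep _ _ _ h01, m01.1⟩
      · exact ⟨⟨step 1 0 1, hstep _ _ _ h01.symm, m10.1⟩,
          two • 1, R.smul_mem R.one_mem _, (C_anti' ((f11 0).mpr rfl)).symm⟩
    · rintro k y ⟨⟨η, hη, h⟩, η', hη', h'⟩
      have hk : k = 0 ∨ k = 1 := by omega
      rcases hk with rfl | rfl
      · refine ⟨⟨η' * step 1 0 1, R.mul_mem hη' (hstep _ _ _ h01.symm), ?_⟩,
          two • η', R.smul_mem hη' _, ?_⟩
        · rw [mul_apply_anti, m10.1, Sq_C, h']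
        · change two • η'.1 _ = _
          rw [h', C_C]; rfl
      · refine ⟨⟨two • η, R.smul_mem hη _, ?_⟩,
          η * step 0 1 1, R.mul_mem hη (hstep _ _ _ h01), ?_⟩
        · change two • η.1 _ = _
          rw [h, C_C]; rfl
        · rw [mul_apply_anti, m01.1, Sq_C, h]
  -- The value of x at a block with wall k is scaled by [2] under C_k, so [2] times it is a value of
  -- R.
  have key : ∀ (x : Sq 1) (γ : Lam 1) (k : Fin 2), fixes γ k →
      (∃ η ∈ R, η.1 (v (anti γ)) = C 1 k (x.1 (v (anti γ)))) → x * proj γ ∈ R := by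
    rintro x γ k hk ⟨η, hη, h⟩
    rw [← Sq_C, C_anti' hk, map_smul] at h
    have e : two • (x * proj γ) = η * proj γ :=
      (((maps_proj γ).comp rfl).smul two).unique ((maps_proj γ).comp h)
    refine hR _ _ evalOne_two_ne ?_
    rw [e]
    exact R.mul_mem hη (hproj γ)
  have hx : ∀ (x : Sq 1) (y : Tn 1), x.1 y ∈ N := fun x y => hN ▸ trivial
  have k01 : ∀ x : Sq 1, x * proj s(0, 1) ∈ R := fun x =>
    key x _ 1 ((f01 1).mpr rfl) (hx x (v (anti s(0, 1)))).1
  have k11 : ∀ x : Sq 1, x * proj s(1, 1) ∈ R := fun x =>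
    key x _ 0 ((f11 0).mpr rfl) (hx x (v (anti s(1, 1)))).2
  -- The block (0,0) is reduced to (0,1) by writing [6] p₀₀ as a loop through (0,1).
  have k00 : ∀ x : Sq 1, x * proj s(0, 0) ∈ R := by
    intro x
    have e : six • (x * proj s((0 : Fin 2), 0)) = x * step 0 1 0 * proj s(0, 1) * step 1 0 0 := by
      rw [← mul_smul_comm, ← loop_eq_six_proj (i := (0 : Fin 2)) (j := 1) rfl (by decide), loop,
        mul_assoc x, Sym2.eq_swap (a := (0 : Fin 2)) (b := 1), (step_block h01 0).2, mul_assoc]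
    refine hR _ _ evalOne_six_ne ?_
    rw [e]
    exact R.mul_mem (k01 _) (hstep _ _ _ h01.symm)
  rw [eq_top_iff]
  intro x _
  rw [← mul_one x, ← sum_proj, Finset.mul_sum]
  refine R.sum_mem fun γ _ => ?_
  rcases hcases γ with rfl | rfl | rfl
  · exact k00 x
  · exact k01 x
  · exact k11 x

theorem eq_top_of_mem {n : ℕ} {R : Subalgebra A (Sq n)} (hR : Saturated R)
    (he : ∀ a, e n a ∈ R) (hf : ∀ a, f n a ∈ R) (ht : t n ∈ R) : R = ⊤ := by
  have hmove : ∀ i j : Fin (n + 1), Adj i j → move i j ∈ R := by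
    intro i j h
    have hi := i.2
    have hj := j.2
    rcases h with h | h
    · obtain ⟨a, rfl, rfl⟩ : ∃ a : Fin n, i = a.castSucc ∧ j = a.succ :=
        ⟨⟨i, by omega⟩, rfl, Fin.ext h.symm⟩
      exact he a
    · obtain ⟨a, rfl, rfl⟩ : ∃ a : Fin n, j = a.castSucc ∧ i = a.succ :=
        ⟨⟨j, by omega⟩, rfl, Fin.ext h.symm⟩
      exact hf a
  -- The element `t` is used only for n = 1.
  match n with
  | 0 => exact eq_top_zero R
  | 1 =>
    have hproj := proj_mem_one hR hmove ht
    exact eq_top_one hR hproj fun i j k h => step_mem hmove hproj h k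
  | n + 2 => exact eq_top_of_two_le (by omega) hR hmove

/-! ### Specialization -/

theorem heckeOp_coeff {n : ℕ} (k : Fin 2) (x : Tn n) (j : X n) : heckeOp n k x j =
    if height k j = 0 then q (-1) * x j
    else if 0 < height k j then x (j.ract (s k))
    else x (j.ract (s k)) + (q (-1) - q 1) * x j := by
  classical
  induction x using Finsupp.induction_linear with
  | zero => simp
  | add x y hx hy =>
    rw [map_add, Finsupp.add_apply, hx, hy]
    split_ifs <;> simp only [Finsupp.add_apply] <;> ring
  | single i b =>
    have : (Finsupp.single i b : Tn n) = b • v i := by simp [v]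
    rw [this, map_smul]
    have hij : i.ract (s k) = j ↔ i = j.ract (s k) :=
      ⟨fun h => by rw [← h, ract_s_s], fun h => by rw [h, ract_s_s]⟩
    have hne : height k j ≠ 0 → j ≠ j.ract (s k) := fun h h' =>
      h ((ract_s_eq_self_iff j k).mp h'.symm)
    by_cases hj : i = j
    · subst hj
      rcases lt_trichotomy (height k i) 0 with h | h | h
      · rw [heckeOp_neg k i h]
        simp [h.ne, h.not_gt, v, hij, hne h.ne, mul_comm]
      · rw [heckeOp_zero k i h]
        simp [h, v, mul_comm]
      · rw [heckeOp_pos k i h]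
        simp [h.ne', h, v, hij, hne h.ne']
    · by_cases hj' : i = j.ract (s k)
      · have e := height_s k j
        rw [← hj'] at e
        have e' : i.ract (s k) = j := hij.mpr hj'
        rcases lt_trichotomy (height k j) 0 with h | h | h
        · rw [heckeOp_pos k i (by omega), e']
          simp [h.ne, h.not_gt, v, hj', (hne h.ne).symm]
        · exact absurd (hj'.trans (ract_eq_self k j h)) hj
        · rw [heckeOp_neg k i (by omega), e']
          simp [h.ne', h, v, hj', (hne h.ne').symm]
      · have hs : (i.ract (s k)) ≠ j := fun h => hj' (hij.mp h)
        rcases lt_trichotomy (height k i) 0 with h | h | h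
        · rw [heckeOp_neg k i h]
          simp [v, hj, hj', hs]
        · rw [heckeOp_zero k i h]
          simp [v, hj, hj']
        · rw [heckeOp_pos k i h]
          simp [v, hj, hj', hs]

theorem weylOp_apply {n : ℕ} (w : W) (z : Tn1 n) (i : X n) : weylOp n w z (i.ract w) = z i := by
  have hinj : Function.Injective fun i : X n => i.ract w := fun i j h => by
    have := congrArg (fun i : X n => i.ract w⁻¹) h
    simpa [ract_ract, ract_one] using this
  exact Finsupp.mapDomain_apply hinj z i

/-- The eigenvector condition says that the coefficient gains a factor q⁻¹ when a wall of ν is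
crossed from positive to negative height. Coefficients z_i q^(−d(i)) satisfy it if d grows by one at
each such crossing. -/
theorem exists_lift {n : ℕ} (ν : Lam n) (z : Tn1 n)
    (hz : ∀ k, fixes ν k → weylOp n (s k) z = z) :
    ∃ x : Tn n, specT x = z ∧ ∀ k, fixes ν k → heckeOp n k x = q (-1) • x := by
  obtain ⟨d, hd⟩ : ∃ d : X n → ℤ, ∀ k, fixes ν k → ∀ i, 0 < height k i →
      d (i.ract (s k)) = d i + 1 := by
    by_cases h : ∀ k, fixes ν k
    · exact ⟨depth, fun k _ i hi => depth_ract_s k i hi⟩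
    · push Not at h
      obtain ⟨m, hm⟩ := h
      -- Since `m` is not a wall, only the other index, `m + 1` in `Fin 2`, can be one, and the sign
      -- of its height suffices.
      refine ⟨fun i => if height (m + 1) i < 0 then 1 else 0, fun k hk i hi => ?_⟩
      have hkm : k ≠ m := by rintro rfl; exact hm hk
      have : k = m + 1 := by omega
      subst this
      simp only [height_s]
      rw [if_pos (by omega), if_neg (by omega), zero_add]
  let x : Tn n := Finsupp.onFinset z.support (fun i => (z i : A) * q (-d i)) fun i h => by
    rw [Finsupp.mem_support_iff]
    intro h0
    exact h (by rw [h0, Int.cast_zero, zero_mul])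
  have hx : ∀ i, x i = (z i : A) * q (-d i) := fun i => rfl
  refine ⟨x, ?_, fun k hk => ?_⟩
  · ext i
    change evalOne (x i) = z i
    rw [hx, map_mul, evalOne_q, mul_one, map_intCast, Int.cast_id]
  · have hzi : ∀ i, z (i.ract (s k)) = z i := fun i => by
      conv_lhs => rw [← hz k hk]
      exact weylOp_apply _ _ _
    ext1 j
    rw [heckeOp_coeff, Finsupp.smul_apply, smul_eq_mul]
    rcases lt_trichotomy (height k j) 0 with h | h | h
    · rw [if_neg h.ne, if_neg h.not_gt, hx, hx, hzi]
      have := hd k hk (j.ract (s k)) (by rw [height_s]; omega)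
      rw [ract_s_s] at this
      rw [this, neg_add, ← q_mul]
      have hqq : q 1 * q (-1) = 1 := by rw [q_mul, add_neg_cancel, q_zero]
      linear_combination (-(z j : A) * q (-d (j.ract (s k)))) * hqq
    · rw [if_pos h]
    · rw [if_neg h.ne', if_pos h, hx, hx, hzi, hd k hk j h, neg_add, ← q_mul]
      ring

theorem spec_val {n : ℕ} (η : Sq n) : (spec η).1 = specEnd η.1 := rfl

theorem S1_ext {n : ℕ} {y z : S1 n}
    (h : ∀ γ, y.1 (Finsupp.single (anti γ) 1) = z.1 (Finsupp.single (anti γ) 1)) : y = z := by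
  have hc : ∀ (y : S1 n) (w : W) (u : Tn1 n), weylOp n w (y.1 u) = y.1 (weylOp n w u) :=
    fun y w u => LinearMap.congr_fun ((Subalgebra.mem_centralizer_iff ℤ).mp y.2 _ ⟨w, rfl⟩) u
  refine Subtype.ext (Finsupp.lhom_ext' fun i => LinearMap.ext_ring ?_)
  obtain ⟨γ, w, rfl⟩ := exists_anti i
  have e : (Finsupp.single ((anti γ).ract w) 1 : Tn1 n) =
      weylOp n w (Finsupp.single (anti γ) 1) := by
    simp [weylOp, Finsupp.lmapDomain_apply]
  change y.1 (Finsupp.single _ 1) = z.1 (Finsupp.single _ 1)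
  rw [e, ← hc, ← hc, h]

theorem specEnd_single {n : ℕ} (η : Module.End A (Tn n)) (i : X n) :
    specEnd η (Finsupp.single i 1) = specT (η (v i)) := by
  rw [← specT_v, specEnd_specT]

theorem spec_add {n : ℕ} (η θ : Sq n) : spec (η + θ) = spec η + spec θ :=
  S1_ext fun γ => by
    change specEnd (η.1 + θ.1) _ = specEnd η.1 _ + specEnd θ.1 _
    rw [specEnd_single, specEnd_single, specEnd_single, LinearMap.add_apply, map_add]

theorem spec_smul {n : ℕ} (c : A) (η : Sq n) : spec (c • η) = evalOne c • spec η :=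
  S1_ext fun γ => by
    change specEnd (c • η.1) _ = evalOne c • specEnd η.1 _
    rw [specEnd_single, specEnd_single, LinearMap.smul_apply, specT_smul]

theorem spec_mul {n : ℕ} (η θ : Sq n) : spec (η * θ) = spec η * spec θ :=
  S1_ext fun γ => by
    change specEnd (η.1 * θ.1) _ = specEnd η.1 (specEnd θ.1 _)
    rw [specEnd_single, specEnd_single, specEnd_specT, Module.End.mul_apply]

theorem spec_one {n : ℕ} : spec (1 : Sq n) = 1 :=
  S1_ext fun γ => by
    change specEnd 1 _ = Finsupp.single _ 1
    rw [specEnd_single, Module.End.one_apply, specT_v]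

theorem spec_surjective (n : ℕ) : Function.Surjective (spec (n := n)) := by
  intro y
  have hinv : ∀ ν k, fixes ν k → weylOp n (s k) (y.1 (Finsupp.single (anti ν) 1)) =
      y.1 (Finsupp.single (anti ν) 1) := by
    intro ν k hk
    have h := LinearMap.congr_fun ((Subalgebra.mem_centralizer_iff ℤ).mp y.2 _ ⟨s k, rfl⟩)
      (Finsupp.single (anti ν) 1)
    change weylOp n (s k) (y.1 _) = y.1 (weylOp n (s k) _) at h
    rw [h, weylOp, Finsupp.lmapDomain_apply, Finsupp.mapDomain_single,
      ract_eq_self k _ (by simpa [fixes] using hk)]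
  choose x hx hx' using fun ν => exists_lift ν (y.1 (Finsupp.single (anti ν) 1)) (hinv ν)
  choose η hη hη' using fun ν => exists_Sq ν (x ν) (hx' ν)
  refine ⟨∑ ν, η ν, S1_ext fun γ => ?_⟩
  rw [spec_val, specEnd_single, AddSubmonoidClass.coe_finsetSum, LinearMap.sum_apply,
    Finset.sum_eq_single γ (fun ν _ h => hη' ν γ h.symm) (by simp), hη, hx]


/-! ### Pulling the generated algebras back to `Sq n`. -/

theorem adjoin_generic_eq_top (n : ℕ) :
    Algebra.adjoin Qq
        ((Set.range fun a : Fin n => (1 : Qq) ⊗ₜ[A] e n a) ∪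
          (Set.range fun a : Fin n => (1 : Qq) ⊗ₜ[A] f n a) ∪
          {(1 : Qq) ⊗ₜ[A] t n}) =
      (⊤ : Subalgebra Qq (Qq ⊗[A] Sq n)) := by
  set S := Algebra.adjoin Qq
        ((Set.range fun a : Fin n => (1 : Qq) ⊗ₜ[A] e n a) ∪
          (Set.range fun a : Fin n => (1 : Qq) ⊗ₜ[A] f n a) ∪ {(1 : Qq) ⊗ₜ[A] t n}) with hS
  let R : Subalgebra A (Sq n) := (S.restrictScalars A).comap
    (Algebra.TensorProduct.includeRight : Sq n →ₐ[A] Qq ⊗[A] Sq n)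
  have hRmem : ∀ x, x ∈ R ↔ (1 : Qq) ⊗ₜ[A] x ∈ S := fun x => Iff.rfl
  -- If c(1) ≠ 0 then c ≠ 0, so c is invertible in ℚ(q).
  have hR : Saturated R := by
    intro c x hc hx
    have hc0 : algebraMap A Qq c ≠ 0 := by
      rw [Ne, map_eq_zero_iff _ (IsFractionRing.injective A Qq)]
      rintro rfl
      exact hc (map_zero _)
    rw [hRmem, TensorProduct.tmul_smul, ← algebraMap_smul Qq c] at hx
    have := S.smul_mem hx (algebraMap A Qq c)⁻¹
    rwa [smul_smul, inv_mul_cancel₀ hc0, one_smul] at this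
  have htop := eq_top_of_mem hR
    (fun a => (hRmem _).mpr (Algebra.subset_adjoin (Or.inl (Or.inl ⟨a, rfl⟩))))
    (fun a => (hRmem _).mpr (Algebra.subset_adjoin (Or.inl (Or.inr ⟨a, rfl⟩))))
    ((hRmem _).mpr (Algebra.subset_adjoin (Or.inr rfl)))
  rw [eq_top_iff]
  intro z _
  induction z using TensorProduct.induction_on with
  | zero => exact S.zero_mem
  | add x y hx hy => exact S.add_mem (hx trivial) (hy trivial)
  | tmul a x =>
    have hx : (1 : Qq) ⊗ₜ[A] x ∈ S := (hRmem x).mp (htop ▸ trivial)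
    have := S.smul_mem hx a
    rwa [TensorProduct.smul_tmul', smul_eq_mul, mul_one] at this

theorem adjoin_spec_eq_top (n : ℕ) :
    Algebra.adjoin ℚ
        ((Set.range fun a : Fin n => (1 : ℚ) ⊗ₜ[ℤ] spec (e n a)) ∪
          (Set.range fun a : Fin n => (1 : ℚ) ⊗ₜ[ℤ] spec (f n a)) ∪
          {(1 : ℚ) ⊗ₜ[ℤ] spec (t n)}) =
      (⊤ : Subalgebra ℚ (ℚ ⊗[ℤ] S1 n)) := by
  set S := Algebra.adjoin ℚ
        ((Set.range fun a : Fin n => (1 : ℚ) ⊗ₜ[ℤ] spec (e n a)) ∪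
          (Set.range fun a : Fin n => (1 : ℚ) ⊗ₜ[ℤ] spec (f n a)) ∪
          {(1 : ℚ) ⊗ₜ[ℤ] spec (t n)}) with hS
  have hsmul : ∀ (c : A) (x : Sq n), (1 : ℚ) ⊗ₜ[ℤ] spec (c • x) =
      (evalOne c : ℚ) • ((1 : ℚ) ⊗ₜ[ℤ] spec x) := by
    intro c x
    rw [spec_smul, TensorProduct.tmul_smul, Int.cast_smul_eq_zsmul]
  -- The preimage is a subalgebra over 𝒜 because `spec` is multiplicative and semilinear along q ↦
  -- 1; it is saturated because c(1) is invertible in ℚ.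
  let R : Subalgebra A (Sq n) :=
    { carrier := {x | (1 : ℚ) ⊗ₜ[ℤ] spec x ∈ S}
      mul_mem' := by
        intro x y hx hy
        have := S.mul_mem hx hy
        rwa [Algebra.TensorProduct.tmul_mul_tmul, one_mul, ← spec_mul] at this
      add_mem' := by
        intro x y hx hy
        have := S.add_mem hx hy
        rwa [← TensorProduct.tmul_add, ← spec_add] at this
      algebraMap_mem' := by
        intro c
        change (1 : ℚ) ⊗ₜ[ℤ] spec (algebraMap A (Sq n) c) ∈ S
        rw [Algebra.algebraMap_eq_smul_one, hsmul, spec_one]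
        exact S.smul_mem S.one_mem _ }
  have hRmem : ∀ x, x ∈ R ↔ (1 : ℚ) ⊗ₜ[ℤ] spec x ∈ S := fun x => Iff.rfl
  have hR : Saturated R := by
    intro c x hc hx
    rw [hRmem, hsmul] at hx
    have := S.smul_mem hx (evalOne c : ℚ)⁻¹
    rwa [smul_smul, inv_mul_cancel₀ (Int.cast_ne_zero.mpr hc), one_smul] at this
  have htop := eq_top_of_mem hR
    (fun a => (hRmem _).mpr (Algebra.subset_adjoin (Or.inl (Or.inl ⟨a, rfl⟩))))
    (fun a => (hRmem _).mpr (Algebra.subset_adjoin (Or.inl (Or.inr ⟨a, rfl⟩))))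
    ((hRmem _).mpr (Algebra.subset_adjoin (Or.inr rfl)))
  rw [eq_top_iff]
  intro z _
  induction z using TensorProduct.induction_on with
  | zero => exact S.zero_mem
  | add x y hx hy => exact S.add_mem (hx trivial) (hy trivial)
  | tmul a y =>
    obtain ⟨x, rfl⟩ := spec_surjective n y
    have hx : (1 : ℚ) ⊗ₜ[ℤ] spec x ∈ S := (hRmem x).mp (htop ▸ trivial)
    have := S.smul_mem hx a
    rwa [TensorProduct.smul_tmul', smul_eq_mul, mul_one] at this

end G2Schur

theorem mainTheorem8 (n : ℕ) :
    Algebra.adjoin G2Schur.Qq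
        ((Set.range fun a : Fin n => (1 : G2Schur.Qq) ⊗ₜ[G2Schur.A] G2Schur.e n a) ∪
          (Set.range fun a : Fin n => (1 : G2Schur.Qq) ⊗ₜ[G2Schur.A] G2Schur.f n a) ∪
          {(1 : G2Schur.Qq) ⊗ₜ[G2Schur.A] G2Schur.t n}) =
      (⊤ : Subalgebra G2Schur.Qq (G2Schur.Qq ⊗[G2Schur.A] G2Schur.Sq n)) ∧
    Algebra.adjoin ℚ
        ((Set.range fun a : Fin n => (1 : ℚ) ⊗ₜ[ℤ] G2Schur.spec (G2Schur.e n a)) ∪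
          (Set.range fun a : Fin n => (1 : ℚ) ⊗ₜ[ℤ] G2Schur.spec (G2Schur.f n a)) ∪
          {(1 : ℚ) ⊗ₜ[ℤ] G2Schur.spec (G2Schur.t n)}) =
      (⊤ : Subalgebra ℚ (ℚ ⊗[ℤ] G2Schur.S1 n)) :=
  ⟨G2Schur.adjoin_generic_eq_top n, G2Schur.adjoin_spec_eq_top n⟩
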